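/- Let $\Omega=(-1,1)$, $-1<\mu<1$, and $w(x)=(1-x^2)^{\mu}$. Let $L^2_w$ be the space of functions on $\Omega$ that are square integrable with respect to $w(x)\,dx$, with norm $\|\cdot\|_{0,w}$, and for an integer $k\ge 0$ let $H^k_w$ be the space of $f\in L^2_w$ whose weak derivatives up to order $k$ lie in $L^2_w$, with norm $\|f\|_{k,w}^2=\sum_{j=0}^k\|f^{(j)}\|_{0,w}^2$. (Since $-1<\mu<1$, elements of $H^1_w$ have a continuous representative on $[-1,1]$.) For $T>0$ let $C^k_T=C([0,T];H^k_w)$ with the norm $\|f\|_{C^k_T}=\max_{0\le t\le T}\|f(t)\|_{k,w}$. Let $b>0$, $w_1(x)=\sinh\frac{1+x}{\sqrt b}$, $w_2(x)=\sinh\frac{1-x}{\sqrt b}$, $W=w_1w_2'-w_1'w_2$ (a nonzero constant), $\alpha=\sinh(2/\sqrt b)$, $$G(x,\xi)=-\frac1{bW}\begin{cases}w_1(\xi)w_2(x), & -1\le \xi\le x,\\ w_1(x)w_2(\xi), & x<\xi\le 1,\end{cases}\qquad (A_Df)(x)=\int_{-1}^1G_\xi(x,\xi)f(\xi)\,d\xi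 .$$ For $T>0$, $h_1,h_2,v_1,v_2\in C([0,T])$ and $\eta_0,u_0$, consider the integral formulation of the Dirichlet problem for the Bona–Smith system with parameters $b$ and $c\le 0$: $$\eta(x,t)=H(x,t)+\int_0^tA_D(u+\eta u)\,d\tau,\qquad u(x,t)=U(x,t)+\int_0^tA_D\Big(c\,\eta_{xx}+\eta+\frac{u^2}2\Big)d\tau,\tag{1}$$ $$H(x,t)=\eta_0(x)+\frac{w_2(x)}{\alpha}(h_1(t)-h_1(0))+\frac{w_1(x)}{\alpha}(h_2(t)-h_2(0)),$$ $$U(x,t)=u_0(x)+\frac{w_2(x)}{\alpha}(v_1(t)-v_1(0))+\frac{w_1(x)}{\alpha}(v_2(t)-v_2(0)).$$ **Theorem.** Let $k=1$ if $c<0$ and $k=2$ if $c=0$. Let $T>0$, $\eta_0\in H^2_w$, $u_0\in H^k_w$ and $h_1,h_2,v_1,v_2\in C([0,T])$ satisfy the compatibility conditions $$\eta_0(-1)=h_1(0),\quad \eta_0(1)=h_2(0),\quad u_0(-1)=v_1(0),\quad u_0(1)=v_2(0).$$ Then there is $T_0\in(0,T]$, depending only on $\mu,b,c,T$ and on upper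 bounds for $\|\eta_0\|_{2,w}$, $\|u_0\|_{k,w}$ and $\max_{[0,T]}|h_i|$, $\max_{[0,T]}|v_i|$, such that (1) has a unique solution $(\eta,u)\in C^2_{T_0}\times C^k_{T_0}$. Moreover: * $\eta-H$ and $u-U$ are differentiable in time on $[0,T_0]$, with values in $H^2_w$ and $H^k_w$ respectively, their time derivatives are continuous, and $$\|\eta\|_{C^2_{T_0}}+\|(\eta-H)_t\|_{C^2_{T_0}}\le C,\qquad \|u\|_{C^k_{T_0}}+\|(u-U)_t\|_{C^k_{T_0}}\le C,$$ where $C$ depends only on the quantities on which $T_0$ depends (and on $T_0$). * If in addition $h_1,h_2,v_1,v_2\in C^1([0,T])$, then $\eta$ and $u$ themselves have time derivatives $\eta_t\in C^2_{T_0}$, $u_t\in C^k_{T_0}$, and $$\|\eta\|_{C^2_{T_0}}+\|\eta_t\|_{C^2_{T_0}}\le C',\qquad \|u\|_{C^k_{T_0}}+\|u_t\|_{C^k_{T_0}}\le C',$$ where $C'$ depends only on the same quantities and on an upper bound for $\max_{[0,T]}|h_i'|$, $\max_{[0,T]}|v_i'|$. -/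

import Mathlib

open Set MeasureTheory
open scoped ENNReal ContDiff

namespace BonaSmith

noncomputable section

/-- The Jacobi weight `w(x) = (1 - x²)^μ` on `Ω = (-1, 1)`. -/
def jacobiWeight (μ x : ℝ) : ℝ := (1 - x ^ 2) ^ μ

/-- The measure `w(x) dx` on `Ω = (-1, 1)`. -/
def jacobiMeasure (μ : ℝ) : Measure ℝ :=
  (volume.restrict (Ioo (-1 : ℝ) 1)).withDensity fun x => ENNReal.ofReal (jacobiWeight μ x)

/-- `g` is the weak derivative of `f` on `Ω = (-1, 1)`, tested against `C_c^∞(Ω)`.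
It is only used for `f, g ∈ L²_w`, which are locally integrable on `Ω`. -/
def HasWeakDeriv (f g : ℝ → ℝ) : Prop :=
  ∀ φ : ℝ → ℝ, ContDiff ℝ ∞ φ → HasCompactSupport φ → tsupport φ ⊆ Ioo (-1 : ℝ) 1 →
    ∫ x in Ioo (-1 : ℝ) 1, f x * deriv φ x = -∫ x in Ioo (-1 : ℝ) 1, g x * φ x

theorem ae_jacobiMeasure {μ : ℝ} {p : ℝ → Prop} (h : ∀ᵐ x ∂jacobiMeasure μ, p x) :
    ∀ᵐ x ∂volume.restrict (Ioo (-1 : ℝ) 1), p x := by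
  have hm : Measurable fun x => ENNReal.ofReal (jacobiWeight μ x) := by
    unfold jacobiWeight; fun_prop
  rw [jacobiMeasure, ae_withDensity_iff hm] at h
  filter_upwards [h, ae_restrict_mem measurableSet_Ioo] with x hx hxI
  apply hx
  have : 0 < jacobiWeight μ x := by
    apply Real.rpow_pos_of_pos
    nlinarith [hxI.1, hxI.2]
  simpa using this

theorem integrableOn_mul {μ : ℝ} (f : Lp ℝ 2 (jacobiMeasure μ)) {ψ : ℝ → ℝ}
    (hψ : Continuous ψ) (hc : HasCompactSupport ψ) (hs : tsupport ψ ⊆ Ioo (-1 : ℝ) 1) :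
    IntegrableOn (fun x => f x * ψ x) (Ioo (-1 : ℝ) 1) := by
  set K := tsupport ψ with hK
  have hKc : IsCompact K := hc
  have hpos : ∀ x ∈ K, 0 < jacobiWeight μ x := fun x hx => by
    apply Real.rpow_pos_of_pos
    nlinarith [(hs hx).1, (hs hx).2]
  have hcont : ContinuousOn (jacobiWeight μ) K := by
    unfold jacobiWeight
    refine ContinuousOn.rpow_const (by fun_prop) fun x hx => Or.inl ?_
    nlinarith [(hs hx).1, (hs hx).2]
  obtain ⟨δ, hδ, hδw⟩ := hKc.exists_forall_le' hcont hpos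
  have hle : volume.restrict K ≤ ENNReal.ofReal δ⁻¹ • jacobiMeasure μ := by
    refine Measure.le_iff.2 fun s hsm => ?_
    have h1 : ENNReal.ofReal δ * volume (s ∩ K) ≤ jacobiMeasure μ s := by
      rw [jacobiMeasure, withDensity_apply _ hsm, Measure.restrict_restrict hsm]
      calc ENNReal.ofReal δ * volume (s ∩ K)
          = ∫⁻ _ in s ∩ K, ENNReal.ofReal δ := by simp
        _ ≤ ∫⁻ x in s ∩ K, ENNReal.ofReal (jacobiWeight μ x) :=
            setLIntegral_mono' (hsm.inter hKc.measurableSet)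
              fun x hx => ENNReal.ofReal_le_ofReal (hδw x hx.2)
        _ ≤ _ := lintegral_mono_set (inter_subset_inter_right s hs)
    rw [Measure.restrict_apply hsm, Measure.smul_apply, smul_eq_mul]
    calc volume (s ∩ K)
        = ENNReal.ofReal δ⁻¹ * (ENNReal.ofReal δ * volume (s ∩ K)) := by
          rw [← mul_assoc, ← ENNReal.ofReal_mul (by positivity), inv_mul_cancel₀ hδ.ne']
          simp
      _ ≤ _ := by gcongr
  have : IsFiniteMeasure (volume.restrict K) :=
    ⟨by simpa using hKc.measure_lt_top⟩
  have hf : IntegrableOn f K :=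
    ((Lp.memLp f).of_measure_le_smul ENNReal.ofReal_ne_top hle).integrable (by norm_num)
  have h2 : IntegrableOn (fun x => f x * ψ x) K := hf.mul_continuousOn hψ.continuousOn hKc
  refine Integrable.integrableOn
    ((integrableOn_iff_integrable_of_support_subset (s := K) fun x hx => ?_).1 h2)
  exact subset_tsupport ψ fun h0 => hx (by simp [h0])

/-- The weighted Sobolev space `H^k_w(Ω)`: a function is stored together with its weak derivatives
up to order `k`, all of them in `L²_w`.  The norm inherited from the Hilbert sum is
`‖f‖_{k,w}² = ∑_{j ≤ k} ‖f^{(j)}‖_{0,w}²`. -/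
def weightedSobolev (μ : ℝ) (k : ℕ) :
    Submodule ℝ (PiLp 2 fun _ : Fin (k + 1) => Lp ℝ 2 (jacobiMeasure μ)) where
  carrier := {f | ∀ j : Fin k, HasWeakDeriv (f j.castSucc) (f j.succ)}
  zero_mem' := fun j φ _ _ _ => by
    have h0 : ∀ᵐ x ∂volume.restrict (Ioo (-1 : ℝ) 1),
        (0 : Lp ℝ 2 (jacobiMeasure μ)) x = 0 := ae_jacobiMeasure (Lp.coeFn_zero ℝ 2 _)
    have e : ∀ ψ : ℝ → ℝ,
        ∫ x in Ioo (-1 : ℝ) 1, (0 : Lp ℝ 2 (jacobiMeasure μ)) x * ψ x = 0 := fun ψ =>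
      integral_eq_zero_of_ae (by filter_upwards [h0] with x hx; rw [hx, zero_mul, Pi.zero_apply])
    simp only [PiLp.zero_apply, e, neg_zero]
  add_mem' := fun {f g} hf hg j φ hφ hc hs => by
    have e : ∀ (i : Fin (k + 1)) (ψ : ℝ → ℝ), Continuous ψ → HasCompactSupport ψ →
        tsupport ψ ⊆ Ioo (-1 : ℝ) 1 →
        ∫ x in Ioo (-1 : ℝ) 1, ((f + g) i : Lp ℝ 2 (jacobiMeasure μ)) x * ψ x =
          (∫ x in Ioo (-1 : ℝ) 1, f i x * ψ x) + ∫ x in Ioo (-1 : ℝ) 1, g i x * ψ x := by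
      intro i ψ h1 h2 h3
      rw [← integral_add (integrableOn_mul (f i) h1 h2 h3) (integrableOn_mul (g i) h1 h2 h3)]
      refine integral_congr_ae ?_
      filter_upwards [ae_jacobiMeasure (Lp.coeFn_add (f i) (g i))] with x hx
      rw [PiLp.add_apply, hx, Pi.add_apply, add_mul]
    rw [e _ _ (hφ.continuous_deriv (by simp)) hc.deriv (tsupport_deriv_subset.trans hs),
      e _ _ hφ.continuous hc hs, hf j φ hφ hc hs, hg j φ hφ hc hs, neg_add]
  smul_mem' := fun a f hf j φ hφ hc hs => by
    have e : ∀ (i : Fin (k + 1)) (ψ : ℝ → ℝ),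
        ∫ x in Ioo (-1 : ℝ) 1, ((a • f) i : Lp ℝ 2 (jacobiMeasure μ)) x * ψ x =
          a * ∫ x in Ioo (-1 : ℝ) 1, f i x * ψ x := by
      intro i ψ
      rw [← integral_const_mul]
      refine integral_congr_ae ?_
      filter_upwards [ae_jacobiMeasure (Lp.coeFn_smul a (f i))] with x hx
      rw [PiLp.smul_apply, hx, Pi.smul_apply, smul_eq_mul, mul_assoc]
    rw [e, e, hf j φ hφ hc hs, mul_neg]

/-- The space `H^k_w(Ω)` as a normed space. -/
abbrev Hw (μ : ℝ) (k : ℕ) : Type := weightedSobolev μ k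

/-- The weak derivative of order `j ≤ k` of `f ∈ H^k_w`, as a function (defined a.e. on `Ω`). -/
def wderiv {μ : ℝ} {k : ℕ} (j : Fin (k + 1)) (f : Hw μ k) : ℝ → ℝ := f.1 j

/-- The function underlying `f ∈ H^k_w` (defined a.e. on `Ω`). -/
def val {μ : ℝ} {k : ℕ} (f : Hw μ k) : ℝ → ℝ := wderiv 0 f

/-- The continuous representative on `[-1, 1]` of `f` takes the values `l` at `-1` and `r` at `1`. -/
def HasBoundaryValues (f : ℝ → ℝ) (l r : ℝ) : Prop :=
  ∃ g : ℝ → ℝ, ContinuousOn g (Icc (-1) 1) ∧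
    (∀ᵐ x ∂volume.restrict (Ioo (-1 : ℝ) 1), f x = g x) ∧ g (-1) = l ∧ g 1 = r

/-- The space `C_T^k = C(0, T; H^k_w)` with the maximum norm. -/
abbrev CHw (T μ : ℝ) (k : ℕ) : Type := C(Icc (0 : ℝ) T, Hw μ k)

/-- `v' ` is the time derivative of `v` on `[0, T]` (one-sided at the end points), the difference
quotients converging in the norm of `E`. -/
def IsTimeDeriv {E : Type*} [NormedAddCommGroup E] [NormedSpace ℝ E] {T : ℝ} (hT : 0 ≤ T)
    (v v' : C(Icc (0 : ℝ) T, E)) : Prop :=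
  ∀ t : Icc (0 : ℝ) T, HasDerivWithinAt (IccExtend hT v) (v' t) (Icc 0 T) t

def w₁ (b x : ℝ) : ℝ := Real.sinh ((1 + x) / √b)

def w₂ (b x : ℝ) : ℝ := Real.sinh ((1 - x) / √b)

/-- The Wronskian `W = w₁ w₂' - w₁' w₂` (a nonzero constant for `b > 0`). -/
def wronskian (b x : ℝ) : ℝ := w₁ b x * deriv (w₂ b) x - deriv (w₁ b) x * w₂ b x

/-- The Green function of `v - b v'' = g`, `v(-1) = v(1) = 0`. -/
def green (b x ξ : ℝ) : ℝ :=
  -(1 / (b * wronskian b x)) * if ξ ≤ x then w₁ b ξ * w₂ b x else w₁ b x * w₂ b ξ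

/-- The operator `A_D f (x) = ∫_{-1}^1 G_ξ(x, ξ) f(ξ) dξ`. -/
def solOp (b : ℝ) (f : ℝ → ℝ) (x : ℝ) : ℝ :=
  ∫ ξ in (-1 : ℝ)..1, deriv (fun ξ' => green b x ξ') ξ * f ξ

/-- The lifting
`f₀(x) + (w₂(x)/α) (g₁(t) - g₁(0)) + (w₁(x)/α) (g₂(t) - g₂(0))` with `α = sinh (2/√b)`. -/
def lift (b : ℝ) (f₀ g₁ g₂ : ℝ → ℝ) (x t : ℝ) : ℝ :=
  f₀ x + w₂ b x / Real.sinh (2 / √b) * (g₁ t - g₁ 0) + w₁ b x / Real.sinh (2 / √b) * (g₂ t - g₂ 0)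

/-- `(η, u) ∈ C_T^2 × C_T^k` solves the integral formulation of the Dirichlet problem with initial
data `η₀, u₀` and boundary data `h₁, h₂` (for `η`) and `v₁, v₂` (for `u`):
for every `t ∈ [0, T]`, as functions of `x ∈ Ω`,
`η = H + ∫₀ᵗ A_D (u + η u) dτ` and `u = U + ∫₀ᵗ A_D (c η_xx + η + u²/2) dτ`. -/
structure IsIntegralSolution {μ : ℝ} {k : ℕ} (b c : ℝ) {T : ℝ} (hT : 0 ≤ T)
    (η₀ : Hw μ 2) (u₀ : Hw μ k) (h₁ h₂ v₁ v₂ : ℝ → ℝ) (η : CHw T μ 2) (u : CHw T μ k) : Prop where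
  eq_η : ∀ t : Icc (0 : ℝ) T, ∀ᵐ x ∂volume.restrict (Ioo (-1 : ℝ) 1),
    val (η t) x = lift b (val η₀) h₁ h₂ x t +
      ∫ τ in (0 : ℝ)..t, solOp b (fun ξ =>
        val (IccExtend hT u τ) ξ + val (IccExtend hT η τ) ξ * val (IccExtend hT u τ) ξ) x
  eq_u : ∀ t : Icc (0 : ℝ) T, ∀ᵐ x ∂volume.restrict (Ioo (-1 : ℝ) 1),
    val (u t) x = lift b (val u₀) v₁ v₂ x t +
      ∫ τ in (0 : ℝ)..t, solOp b (fun ξ =>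
        c * wderiv 2 (IccExtend hT η τ) ξ + val (IccExtend hT η τ) ξ
          + val (IccExtend hT u τ) ξ ^ 2 / 2) x

end

end BonaSmith

/-! ### The weight, the space `L2w`, and bounded primitives. -/

namespace BonaSmith

noncomputable section

open Filter Topology BoundedContinuousFunction

/-! The system is an ordinary differential equation in disguise: `A_D` is smoothing enough to make
the right-hand side a locally Lipschitz vector field on `H²_w × H^k_w`.

Weighted spaces. Since `-1 < μ`, the measure is finite and bounded continuous functions lie in
`L²_w`; since `μ < 1`, the function `1/w` is integrable and Cauchy–Schwarz embeds `L²_w` in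
`L¹(-1,1)` (`lintegral_enorm_le`). Hence every `f` in `L²_w` has a bounded continuous primitive,
depending boundedly on `f`. A function with zero weak derivative is constant (`exists_ae_eq_const`),
so elements of `H¹_w` are primitives plus constants (`toL2w_representative`). The product rule
(`IsPrimitive.mul`) then makes `H¹_w` an algebra with bounded multiplication
(`exists_norm_mulHw_le`).

Gain of a derivative. `A_D f` is a combination of hyperbolic functions times primitives of `f` times
hyperbolic functions. Differentiating gives `(A_D f)' = f/b + r` with `r' = A_D f / b`
(`isPrimitive_greenOp`, `isPrimitive_greenDerivOp`). So `A_D` maps `L²_w` to `H¹_w` and `H¹_w` to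
`H²_w`. The term `u + ηu` is in `H¹_w`, so the first equation takes values in `H²_w`. In the second,
`c η_xx` is only in `L²_w`, which gives `k = 1`; when `c = 0` this term is absent and `k = 2`.

The evolution. With `Y = (H, U)` and `y = (η, u)`, the system reads `y = Y + ∫ B(y)` with `B` at
most quadratic and `B 0 = 0` (`IsSystem.isIntegralSolution_iff`). As `Y` is merely continuous in
time, one solves for `p = y - Y`, which satisfies `p' = B(Y + p)`, `p(0) = 0`: Picard–Lindelöf gives
existence on a time depending only on a bound for `Y` (`exists_volterra`), and Gronwall gives
uniqueness (`volterra_unique`). The time derivative of `y - Y` is `B(y)`; if the boundary data are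
`C¹`, so is `Y`, and hence `y` (`time_regularity`). -/

theorem jacobiWeight_pos (μ : ℝ) {x : ℝ} (hx : x ∈ Ioo (-1 : ℝ) 1) : 0 < jacobiWeight μ x :=
  Real.rpow_pos_of_pos (by nlinarith [hx.1, hx.2]) _

theorem measurable_jacobiWeight (μ : ℝ) : Measurable (jacobiWeight μ) := by
  unfold jacobiWeight; fun_prop

/-- The weight factors as `(1 - x)^μ (1 + x)^μ`. On each half of the interval one factor is
continuous and the other is an integrable power of the distance to an endpoint. -/
theorem integrableOn_jacobiWeight {μ : ℝ} (hμ : -1 < μ) :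
    IntegrableOn (jacobiWeight μ) (Ioo (-1 : ℝ) 1) := by
  have hfac : ∀ x ∈ Icc (-1 : ℝ) 1, (1 - x) ^ μ * (1 + x) ^ μ = jacobiWeight μ x := by
    intro x hx
    rw [jacobiWeight, ← Real.mul_rpow (by linarith [hx.2]) (by linarith [hx.1])]
    congr 1; ring
  have hleft : IntervalIntegrable (jacobiWeight μ) volume (-1) 0 := by
    have h1 : IntervalIntegrable (fun x : ℝ => (1 + x) ^ μ) volume (-1) 0 := by
      have := (intervalIntegral.intervalIntegrable_rpow' (a := 0) (b := 1) hμ).comp_add_left 1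
      simpa using this
    refine (h1.continuousOn_mul (g := fun x : ℝ => (1 - x) ^ μ) ?_).congr ?_
    · refine ContinuousOn.rpow_const (by fun_prop) fun x hx => Or.inl ?_
      rw [uIcc_of_le (by norm_num)] at hx
      linarith [hx.2]
    · intro x hx
      rw [uIoc_of_le (by norm_num)] at hx
      exact hfac x ⟨hx.1.le, by linarith [hx.2]⟩
  have hright : IntervalIntegrable (jacobiWeight μ) volume 0 1 := by
    have h1 : IntervalIntegrable (fun x : ℝ => (1 - x) ^ μ) volume 0 1 := by
      have := (intervalIntegral.intervalIntegrable_rpow' (a := 1) (b := 0) hμ).comp_sub_left 1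
      simpa using this
    refine (h1.mul_continuousOn (g := fun x : ℝ => (1 + x) ^ μ) ?_).congr ?_
    · refine ContinuousOn.rpow_const (by fun_prop) fun x hx => Or.inl ?_
      rw [uIcc_of_le (by norm_num)] at hx
      linarith [hx.1]
    · intro x hx
      rw [uIoc_of_le (by norm_num)] at hx
      exact hfac x ⟨by linarith [hx.1], hx.2⟩
  have := hleft.trans hright
  rw [intervalIntegrable_iff_integrableOn_Ioo_of_le (by norm_num)] at this
  exact this

/-- The space `L²_w`. -/
abbrev L2w (μ : ℝ) : Type := Lp ℝ 2 (jacobiMeasure μ)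

instance isFiniteMeasure_jacobiMeasure {μ : ℝ} [h : Fact (-1 < μ)] :
    IsFiniteMeasure (jacobiMeasure μ) := by
  refine isFiniteMeasure_withDensity ?_
  exact (integrableOn_jacobiWeight h.out).lintegral_lt_top.ne

theorem jacobiMeasure_absolutelyContinuous (μ : ℝ) :
    jacobiMeasure μ ≪ volume.restrict (Ioo (-1 : ℝ) 1) :=
  withDensity_absolutelyContinuous _ _

theorem L2w_ext {μ : ℝ} {f g : L2w μ}
    (h : ∀ᵐ x ∂volume.restrict (Ioo (-1 : ℝ) 1), f x = g x) : f = g :=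
  Lp.ext ((jacobiMeasure_absolutelyContinuous μ).ae_le h)

section

variable {μ : ℝ} [Fact (-1 < μ)]

/-- Bounded continuous functions as elements of `L²_w`. -/
def toL2w : (ℝ →ᵇ ℝ) →L[ℝ] L2w μ := BoundedContinuousFunction.toLp 2 (jacobiMeasure μ) ℝ

theorem coeFn_toL2w (F : ℝ →ᵇ ℝ) :
    ∀ᵐ x ∂volume.restrict (Ioo (-1 : ℝ) 1), (toL2w F : L2w μ) x = F x :=
  ae_jacobiMeasure (BoundedContinuousFunction.coeFn_toLp 2 (jacobiMeasure μ) ℝ F)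

/-- Multiplication of elements of `L²_w` by bounded continuous functions. -/
def mulL2w : (ℝ →ᵇ ℝ) →L[ℝ] L2w μ →L[ℝ] L2w μ :=
  ((ContinuousLinearMap.mul ℝ ℝ).holderL (jacobiMeasure μ) (⊤ : ℝ≥0∞) 2 2).comp
    (BoundedContinuousFunction.toLp (⊤ : ℝ≥0∞) (jacobiMeasure μ) ℝ)

theorem coeFn_mulL2w (F : ℝ →ᵇ ℝ) (f : L2w μ) :
    ∀ᵐ x ∂volume.restrict (Ioo (-1 : ℝ) 1), (mulL2w F f : L2w μ) x = F x * f x := by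
  refine ae_jacobiMeasure (μ := μ) ?_
  filter_upwards [(ContinuousLinearMap.mul ℝ ℝ).coeFn_holder (r := 2)
      (BoundedContinuousFunction.toLp (⊤ : ℝ≥0∞) (jacobiMeasure μ) ℝ F) f,
    BoundedContinuousFunction.coeFn_toLp (⊤ : ℝ≥0∞) (jacobiMeasure μ) ℝ F] with x h1 h2
  rw [← h2]
  exact h1

end

/-- The norm of the inclusion of `L²_w` into `L¹(-1, 1)`. -/
def inclConst (μ : ℝ) : ℝ≥0∞ :=
  (∫⁻ x in Ioo (-1 : ℝ) 1, ENNReal.ofReal (jacobiWeight (-μ) x)) ^ (1 / 2 : ℝ)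

theorem inclConst_ne_top {μ : ℝ} [hμ : Fact (μ < 1)] : inclConst μ ≠ ⊤ := by
  refine ENNReal.rpow_ne_top_of_nonneg (by norm_num) ?_
  exact (integrableOn_jacobiWeight (by linarith [hμ.out])).lintegral_lt_top.ne

/-- Cauchy–Schwarz applied to `|f| = (|f| w^{1/2}) · w^{-1/2}`. The second factor has square `(1 -
x²)^(-μ)`, which is integrable exactly because `μ < 1`. -/
theorem lintegral_enorm_le {μ : ℝ} (f : L2w μ) :
    ∫⁻ x in Ioo (-1 : ℝ) 1, ‖f x‖ₑ ≤ ‖f‖ₑ * inclConst μ := by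
  have hw : ∀ ν, Measurable fun x => ENNReal.ofReal (jacobiWeight ν x) := fun ν =>
    (measurable_jacobiWeight ν).ennreal_ofReal
  have hfm : Measurable f := (Lp.stronglyMeasurable f).measurable
  have h2 : ∀ x ∈ Ioo (-1 : ℝ) 1, ∀ ν, ENNReal.ofReal (jacobiWeight (ν / 2) x) ^ (2 : ℝ) =
      ENNReal.ofReal (jacobiWeight ν x) := by
    intro x hx ν
    rw [ENNReal.ofReal_rpow_of_pos (jacobiWeight_pos _ hx), jacobiWeight, jacobiWeight,
      ← Real.rpow_mul (by nlinarith [hx.1, hx.2])]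
    congr 2; ring
  have h1 : ∀ x ∈ Ioo (-1 : ℝ) 1, ENNReal.ofReal (jacobiWeight (μ / 2) x) *
      ENNReal.ofReal (jacobiWeight (-μ / 2) x) = 1 := by
    intro x hx
    rw [← ENNReal.ofReal_mul (jacobiWeight_pos _ hx).le, jacobiWeight, jacobiWeight,
      ← Real.rpow_add (by nlinarith [hx.1, hx.2])]
    simp [neg_div]
  have hn : ‖f‖ₑ = (∫⁻ x in Ioo (-1 : ℝ) 1,
      (‖f x‖ₑ * ENNReal.ofReal (jacobiWeight (μ / 2) x)) ^ (2 : ℝ)) ^ (1 / 2 : ℝ) := by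
    rw [Lp.enorm_def, eLpNorm_eq_lintegral_rpow_enorm_toReal (by norm_num) (by norm_num)]
    simp only [ENNReal.toReal_ofNat]
    congr 1
    refine (lintegral_withDensity_eq_lintegral_mul _ (hw μ) (by fun_prop)).trans ?_
    refine setLIntegral_congr_fun measurableSet_Ioo fun x hx => ?_
    simp only [Pi.mul_apply]
    rw [ENNReal.mul_rpow_of_nonneg _ _ (by norm_num), h2 x hx, mul_comm]
  calc ∫⁻ x in Ioo (-1 : ℝ) 1, ‖f x‖ₑ
      = ∫⁻ x in Ioo (-1 : ℝ) 1, ((fun x => ‖f x‖ₑ * ENNReal.ofReal (jacobiWeight (μ / 2) x)) *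
          fun x => ENNReal.ofReal (jacobiWeight (-μ / 2) x)) x := by
        refine setLIntegral_congr_fun measurableSet_Ioo fun x hx => ?_
        simp only [Pi.mul_apply]
        rw [mul_assoc, h1 x hx, mul_one]
    _ ≤ (∫⁻ x in Ioo (-1 : ℝ) 1,
          (‖f x‖ₑ * ENNReal.ofReal (jacobiWeight (μ / 2) x)) ^ (2 : ℝ)) ^ (1 / 2 : ℝ) *
        (∫⁻ x in Ioo (-1 : ℝ) 1, ENNReal.ofReal (jacobiWeight (-μ / 2) x) ^ (2 : ℝ)) ^
          (1 / 2 : ℝ) :=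
        ENNReal.lintegral_mul_le_Lp_mul_Lq _ Real.HolderConjugate.two_two
          (hfm.enorm.mul (hw _)).aemeasurable (hw _).aemeasurable
    _ = ‖f‖ₑ * inclConst μ := by
        rw [hn, inclConst]
        congr 2
        exact setLIntegral_congr_fun measurableSet_Ioo fun x hx => h2 x hx _

variable {μ : ℝ} [Fact (μ < 1)]

theorem integrableOn_L2w (f : L2w μ) : IntegrableOn f (Ioo (-1 : ℝ) 1) := by
  refine ⟨(Lp.stronglyMeasurable f).aestronglyMeasurable, ?_⟩
  exact (lintegral_enorm_le f).trans_lt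
    (ENNReal.mul_lt_top enorm_lt_top inclConst_ne_top.lt_top)

theorem integral_norm_le (f : L2w μ) :
    ∫ x in Ioo (-1 : ℝ) 1, ‖f x‖ ≤ (inclConst μ).toReal * ‖f‖ := by
  rw [integral_norm_eq_lintegral_enorm (Lp.stronglyMeasurable f).aestronglyMeasurable]
  refine (ENNReal.toReal_mono (ENNReal.mul_ne_top enorm_ne_top inclConst_ne_top)
    (lintegral_enorm_le f)).trans ?_
  rw [ENNReal.toReal_mul, toReal_enorm, mul_comm]

theorem integrableOn_L2w_Ioo_inter (f : L2w μ) (x : ℝ) :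
    IntegrableOn f (Ioo (-1 : ℝ) 1 ∩ Iic x) :=
  (integrableOn_L2w f).mono_set inter_subset_left

/-- Integrating over `Ioo (-1) 1 ∩ Iic x` amounts to extending `f` by zero, so the primitive is
defined, continuous and bounded on the whole line and can serve as an element of `ℝ →ᵇ ℝ`. -/
theorem continuous_primitive_L2w (f : L2w μ) :
    Continuous fun x : ℝ => ∫ ξ in Ioo (-1 : ℝ) 1 ∩ Iic x, f ξ := by
  have h : ∀ x : ℝ, ∫ ξ in Ioo (-1 : ℝ) 1 ∩ Iic x, f ξ =
      ∫ ξ in Iic x, (Ioo (-1 : ℝ) 1).indicator f ξ := fun x => by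
    rw [inter_comm, setIntegral_indicator measurableSet_Ioo]
  have hi : Integrable ((Ioo (-1 : ℝ) 1).indicator f) :=
    (integrable_indicator_iff measurableSet_Ioo).2 (integrableOn_L2w f)
  have h2 : ∀ x : ℝ, ∫ ξ in Ioo (-1 : ℝ) 1 ∩ Iic x, f ξ =
      (∫ ξ in Iic 0, (Ioo (-1 : ℝ) 1).indicator f ξ) +
        ∫ ξ in (0 : ℝ)..x, (Ioo (-1 : ℝ) 1).indicator f ξ := fun x => by
    rw [h, ← intervalIntegral.integral_Iic_sub_Iic hi.integrableOn hi.integrableOn]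
    ring
  simp only [h2]
  exact continuous_const.add (intervalIntegral.continuous_primitive
    (fun a b => hi.intervalIntegrable) 0)

theorem norm_primitive_L2w_le (f : L2w μ) (x : ℝ) :
    ‖∫ ξ in Ioo (-1 : ℝ) 1 ∩ Iic x, f ξ‖ ≤ (inclConst μ).toReal * ‖f‖ := by
  refine (norm_integral_le_integral_norm _).trans (le_trans ?_ (integral_norm_le f))
  exact setIntegral_mono_set (integrableOn_L2w f).norm (ae_of_all _ fun _ => norm_nonneg _)
    (inter_subset_left.eventuallyLE)

/-- The primitive vanishing at `-1`, as a bounded operator from `L²_w` to bounded continuous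
functions. -/
def primitive : L2w μ →L[ℝ] (ℝ →ᵇ ℝ) :=
  LinearMap.mkContinuous
    { toFun := fun f => BoundedContinuousFunction.ofNormedAddCommGroup _
        (continuous_primitive_L2w f) _ (norm_primitive_L2w_le f)
      map_add' := fun f g => by
        ext x
        change ∫ ξ in Ioo (-1 : ℝ) 1 ∩ Iic x, (f + g : L2w μ) ξ =
          (∫ ξ in Ioo (-1 : ℝ) 1 ∩ Iic x, f ξ) + ∫ ξ in Ioo (-1 : ℝ) 1 ∩ Iic x, g ξ
        rw [← integral_add (integrableOn_L2w_Ioo_inter f x) (integrableOn_L2w_Ioo_inter g x)]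
        exact integral_congr_ae
          (ae_restrict_of_ae_restrict_of_subset inter_subset_left
            (ae_jacobiMeasure (Lp.coeFn_add f g)))
      map_smul' := fun a f => by
        ext x
        change ∫ ξ in Ioo (-1 : ℝ) 1 ∩ Iic x, (a • f : L2w μ) ξ =
          a * ∫ ξ in Ioo (-1 : ℝ) 1 ∩ Iic x, f ξ
        rw [← integral_const_mul]
        exact integral_congr_ae
          (ae_restrict_of_ae_restrict_of_subset inter_subset_left
            (ae_jacobiMeasure (Lp.coeFn_smul a f))) }
    (inclConst μ).toReal
    fun f => (BoundedContinuousFunction.norm_le (by positivity)).2 (norm_primitive_L2w_le f)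

theorem primitive_apply (f : L2w μ) (x : ℝ) :
    primitive f x = ∫ ξ in Ioo (-1 : ℝ) 1 ∩ Iic x, f ξ := rfl

theorem intervalIntegrable_L2w (f : L2w μ) : IntervalIntegrable f volume (-1) 1 :=
  (intervalIntegrable_iff_integrableOn_Ioo_of_le (by norm_num)).2 (integrableOn_L2w f)

theorem primitive_eq_intervalIntegral (f : L2w μ) {x : ℝ} (hx : x ∈ Icc (-1 : ℝ) 1) :
    primitive f x = ∫ ξ in (-1 : ℝ)..x, f ξ := by
  rw [primitive_apply, intervalIntegral.integral_of_le hx.1]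
  refine setIntegral_congr_set ?_
  have h1 : (Ioo (-1 : ℝ) 1 ∩ Iic x : Set ℝ) =ᵐ[volume] (Ioc (-1 : ℝ) 1 ∩ Iic x : Set ℝ) :=
    Ioo_ae_eq_Ioc.inter (ae_eq_refl _)
  rwa [Ioc_inter_Iic, min_eq_right hx.2] at h1

end

end BonaSmith

/-! ### Weak derivatives, continuous representatives and completeness of `Hw`. -/

namespace BonaSmith

noncomputable section

set_option linter.unusedSectionVars false

open Filter Topology BoundedContinuousFunction

/-- The bounded continuous function that agrees with `g` on `[-1, 1]` and is constant on either side
of it. -/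
def clamp (g : ℝ → ℝ) (hg : Continuous g) : ℝ →ᵇ ℝ :=
  (BoundedContinuousFunction.mkOfCompact
    (⟨fun x : Icc (-1 : ℝ) 1 => g x, by fun_prop⟩ : C(Icc (-1 : ℝ) 1, ℝ))).compContinuous
    ⟨projIcc (-1 : ℝ) 1 (by norm_num), continuous_projIcc⟩

theorem clamp_apply {g : ℝ → ℝ} (hg : Continuous g) {x : ℝ} (hx : x ∈ Icc (-1 : ℝ) 1) :
    clamp g hg x = g x := by
  change g (projIcc (-1 : ℝ) 1 (by norm_num) x) = g x
  rw [projIcc_of_mem _ hx]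

theorem left_mem : (-1 : ℝ) ∈ Icc (-1 : ℝ) 1 := by simp

theorem right_mem : (1 : ℝ) ∈ Icc (-1 : ℝ) 1 := by simp

theorem eq_zero_of_tsupport_subset {φ : ℝ → ℝ} (hs : tsupport φ ⊆ Ioo (-1 : ℝ) 1) {x : ℝ}
    (hx : x ∉ Ioo (-1 : ℝ) 1) : φ x = 0 :=
  image_eq_zero_of_notMem_tsupport fun h => hx (hs h)

/-- A locally integrable function on `(-1, 1)` with vanishing weak derivative is constant. -/
theorem exists_ae_eq_const {h : ℝ → ℝ} (hi : IntegrableOn h (Ioo (-1 : ℝ) 1))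
    (H : ∀ φ : ℝ → ℝ, ContDiff ℝ ∞ φ → HasCompactSupport φ → tsupport φ ⊆ Ioo (-1 : ℝ) 1 →
      ∫ x in Ioo (-1 : ℝ) 1, h x * deriv φ x = 0) :
    ∃ c, ∀ᵐ x ∂volume.restrict (Ioo (-1 : ℝ) 1), h x = c := by
  let B : ContDiffBump (0 : ℝ) := ⟨1 / 4, 1 / 2, by norm_num, by norm_num⟩
  set ψ₀ : ℝ → ℝ := B.normed volume with hψ₀
  have hψ₀s : tsupport ψ₀ ⊆ Ioo (-1 : ℝ) 1 := by
    rw [hψ₀, B.tsupport_normed_eq, Real.closedBall_eq_Icc]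
    exact Icc_subset_Ioo (by norm_num) (by norm_num)
  have hψ₀c : HasCompactSupport ψ₀ := B.hasCompactSupport_normed
  have hψ₀d : ContDiff ℝ ∞ ψ₀ := B.contDiff_normed
  have hmul : ∀ g : ℝ → ℝ, Continuous g → IntegrableOn (fun x => h x * g x) (Ioo (-1 : ℝ) 1) :=
    fun g hg => by
      rw [← integrableOn_Icc_iff_integrableOn_Ioo] at hi ⊢
      exact hi.mul_continuousOn hg.continuousOn isCompact_Icc
  refine ⟨∫ x in Ioo (-1 : ℝ) 1, h x * ψ₀ x, ?_⟩
  set c := ∫ x in Ioo (-1 : ℝ) 1, h x * ψ₀ x with hc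
  -- Subtracting the multiple of the unit-mass bump `ψ₀` with the same integral leaves a function of
  -- mean zero, which is therefore the derivative of a test function.
  have key : ∀ g : ℝ → ℝ, ContDiff ℝ ∞ g → HasCompactSupport g → tsupport g ⊆ Ioo (-1 : ℝ) 1 →
      ∫ x in Ioo (-1 : ℝ) 1, h x * g x = c * ∫ x, g x := by
    intro g hg hgc hgs
    set a := ∫ x, g x with ha
    set ψ : ℝ → ℝ := fun x => g x - a * ψ₀ x with hψ
    have hψd : ContDiff ℝ ∞ ψ := hg.sub (contDiff_const.mul hψ₀d)
    have hψint : ∫ x, ψ x = 0 := by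
      rw [hψ, integral_sub (hg.continuous.integrable_of_hasCompactSupport hgc)
        ((hψ₀d.continuous.integrable_of_hasCompactSupport hψ₀c).const_mul a), integral_const_mul,
        hψ₀, B.integral_normed, mul_one, ha, sub_self]
    -- A radius strictly below 1 is needed so that the closed support of the primitive of `ψ` stays
    -- inside the open interval.
    obtain ⟨r, hr0, hr1, hr⟩ : ∃ r : ℝ, 0 ≤ r ∧ r < 1 ∧ ∀ x, ψ x ≠ 0 → |x| ≤ r := by
      have hK : IsCompact (tsupport g ∪ tsupport ψ₀) := hgc.isCompact.union hψ₀c.isCompact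
      have hne : (tsupport g ∪ tsupport ψ₀).Nonempty := by
        refine ⟨0, Or.inr ?_⟩
        rw [hψ₀, B.tsupport_normed_eq]
        exact Metric.mem_closedBall_self B.rOut_pos.le
      obtain ⟨z, hz, hmax⟩ := hK.exists_isMaxOn hne (continuous_abs.continuousOn)
      refine ⟨|z|, abs_nonneg z, ?_, fun x hx => hmax ?_⟩
      · have := union_subset hgs hψ₀s hz
        exact abs_lt.2 this
      · by_contra hx'
        rw [mem_union, not_or] at hx'
        exact hx (by simp [hψ, image_eq_zero_of_notMem_tsupport hx'.1,
          image_eq_zero_of_notMem_tsupport hx'.2])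
    set φ : ℝ → ℝ := fun x => ∫ y in (-1 : ℝ)..x, ψ y with hφ
    have hφ' : ∀ x, HasDerivAt φ (ψ x) x := fun x =>
      hψd.continuous.integral_hasStrictDerivAt (-1) x |>.hasDerivAt
    have hφd : deriv φ = ψ := funext fun x => (hφ' x).deriv
    have hφs : Function.support φ ⊆ Icc (-r) r := by
      intro x hx
      by_contra hxr
      apply hx
      rw [mem_Icc, not_and_or, not_le, not_le] at hxr
      rcases hxr with hxr | hxr
      · rw [hφ]
        refine (intervalIntegral.integral_congr (g := fun _ => 0) fun y hy => ?_).trans (by simp)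
        by_contra hy0
        have h1 := neg_le_of_abs_le (hr y hy0)
        rw [mem_uIcc] at hy
        rcases hy with hy | hy <;> linarith [hy.1, hy.2]
      -- To the right of the support the primitive equals the total integral of `ψ`, which is zero.
      · rw [hφ, ← hψint]
        refine intervalIntegral.integral_eq_integral_of_support_subset fun y hy => ?_
        have := abs_le.1 (hr y hy)
        exact ⟨by linarith, by linarith⟩
    have hφc : HasCompactSupport φ := HasCompactSupport.of_support_subset_isCompact isCompact_Icc hφs
    have hφts : tsupport φ ⊆ Ioo (-1 : ℝ) 1 :=
      (closure_minimal hφs isClosed_Icc).trans (Icc_subset_Ioo (by linarith) hr1)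
    have hφsm : ContDiff ℝ ∞ φ :=
      contDiff_infty_iff_deriv.2 ⟨fun x => (hφ' x).differentiableAt, hφd ▸ hψd⟩
    have h0 := H φ hφsm hφc hφts
    rw [hφd] at h0
    have e : ∀ x, h x * ψ x = h x * g x - a * (h x * ψ₀ x) := fun x => by simp only [hψ]; ring
    simp only [e] at h0
    rw [integral_sub (hmul g hg.continuous) ((hmul ψ₀ hψ₀d.continuous).const_mul a),
      integral_const_mul] at h0
    linarith
  have hz : ∀ᵐ x ∂volume, x ∈ Ioo (-1 : ℝ) 1 → h x - c = 0 := by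
    have hic : IntegrableOn (fun x => h x - c) (Ioo (-1 : ℝ) 1) :=
      hi.sub (integrableOn_const (by simp))
    refine isOpen_Ioo.ae_eq_zero_of_integral_contDiff_smul_eq_zero hic.locallyIntegrableOn ?_
    intro g hg hgc hgs
    have e : ∫ x, g x • (h x - c) = ∫ x in Ioo (-1 : ℝ) 1, g x • (h x - c) :=
      (setIntegral_eq_integral_of_forall_compl_eq_zero fun x hx => by
        simp [eq_zero_of_tsupport_subset hgs hx]).symm
    have e2 : ∫ x in Ioo (-1 : ℝ) 1, g x = ∫ x, g x :=
      setIntegral_eq_integral_of_forall_compl_eq_zero fun x hx =>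
        eq_zero_of_tsupport_subset hgs hx
    have e3 : ∀ x, g x • (h x - c) = h x * g x - c * g x := fun x => by
      rw [smul_eq_mul]; ring
    rw [e]
    simp only [e3]
    rw [integral_sub (hmul g hg.continuous)
      ((hg.continuous.integrable_of_hasCompactSupport hgc).integrableOn.const_mul c),
      key g hg hgc hgs, integral_const_mul, e2, sub_self]
  rw [ae_restrict_iff' measurableSet_Ioo]
  filter_upwards [hz] with x hx hxI
  linarith [hx hxI]

variable {μ : ℝ} [Fact (-1 < μ)] [Fact (μ < 1)]

/-- The difference of two weak derivatives is orthogonal to all test functions, hence zero almost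
everywhere. -/
theorem HasWeakDeriv.unique {h : ℝ → ℝ} {f g : L2w μ} (hf : HasWeakDeriv h f)
    (hg : HasWeakDeriv h g) : f = g := by
  refine L2w_ext ?_
  have hi : IntegrableOn (fun x => f x - g x) (Ioo (-1 : ℝ) 1) :=
    (integrableOn_L2w f).sub (integrableOn_L2w g)
  have hz : ∀ᵐ x ∂volume, x ∈ Ioo (-1 : ℝ) 1 → f x - g x = 0 := by
    refine isOpen_Ioo.ae_eq_zero_of_integral_contDiff_smul_eq_zero hi.locallyIntegrableOn ?_
    intro φ hφ hφc hφs
    have e : ∫ x, φ x • (f x - g x) = ∫ x in Ioo (-1 : ℝ) 1, φ x • (f x - g x) :=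
      (setIntegral_eq_integral_of_forall_compl_eq_zero fun x hx => by
        simp [eq_zero_of_tsupport_subset hφs hx]).symm
    have e3 : ∀ x, φ x • (f x - g x) = f x * φ x - g x * φ x := fun x => by
      rw [smul_eq_mul]; ring
    rw [e]
    simp only [e3]
    rw [integral_sub (integrableOn_mul f hφ.continuous hφc hφs)
      (integrableOn_mul g hφ.continuous hφc hφs)]
    linarith [hf φ hφ hφc hφs, hg φ hφ hφc hφs]
  rw [ae_restrict_iff' measurableSet_Ioo]
  filter_upwards [hz] with x hx hxI
  linarith [hx hxI]

/-- `f` is the derivative of `F` on `(-1, 1)`, in integrated form. -/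
def IsPrimitive (F : ℝ →ᵇ ℝ) (f : L2w μ) : Prop :=
  ∀ x ∈ Icc (-1 : ℝ) 1, F x = F (-1) + primitive f x

theorem IsPrimitive.add {F G : ℝ →ᵇ ℝ} {f g : L2w μ} (hF : IsPrimitive F f)
    (hG : IsPrimitive G g) : IsPrimitive (F + G) (f + g) := fun x hx => by
  simp only [map_add, BoundedContinuousFunction.add_apply, hF x hx, hG x hx]; ring

theorem IsPrimitive.sub {F G : ℝ →ᵇ ℝ} {f g : L2w μ} (hF : IsPrimitive F f)
    (hG : IsPrimitive G g) : IsPrimitive (F - G) (f - g) := fun x hx => by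
  simp only [map_sub, BoundedContinuousFunction.sub_apply, hF x hx, hG x hx]; ring

theorem IsPrimitive.smul {F : ℝ →ᵇ ℝ} {f : L2w μ} (a : ℝ) (hF : IsPrimitive F f) :
    IsPrimitive (a • F) (a • f) := fun x hx => by
  simp only [map_smul, BoundedContinuousFunction.coe_smul, hF x hx, smul_eq_mul]; ring

theorem primitive_left (f : L2w μ) : primitive f (-1) = 0 := by
  rw [primitive_eq_intervalIntegral f left_mem, intervalIntegral.integral_same]

theorem isPrimitive_primitive (f : L2w μ) : IsPrimitive (primitive f) f := fun x _ => by
  rw [primitive_left, zero_add]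

theorem isPrimitive_const (a : ℝ) : IsPrimitive (a • (1 : ℝ →ᵇ ℝ)) (0 : L2w μ) := fun x _ => by
  simp

/-- The fundamental theorem of calculus; it brings the hyperbolic functions and the test functions
into the calculus of `IsPrimitive`. -/
theorem isPrimitive_clamp {g g' : ℝ → ℝ} (hg' : Continuous g')
    (h : ∀ x, HasDerivAt g (g' x) x) :
    IsPrimitive (clamp g (continuous_iff_continuousAt.2 fun x => (h x).continuousAt))
      (toL2w (clamp g' hg') : L2w μ) := fun x hx => by
  have hc : Continuous g := continuous_iff_continuousAt.2 fun x => (h x).continuousAt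
  rw [clamp_apply hc hx, clamp_apply hc left_mem, primitive_eq_intervalIntegral _ hx]
  have : ∫ ξ in (-1 : ℝ)..x, (toL2w (clamp g' hg') : L2w μ) ξ = ∫ ξ in (-1 : ℝ)..x, g' ξ := by
    rw [intervalIntegral.integral_of_le hx.1, intervalIntegral.integral_of_le hx.1,
      integral_Ioc_eq_integral_Ioo, integral_Ioc_eq_integral_Ioo]
    refine integral_congr_ae ?_
    filter_upwards [ae_restrict_of_ae_restrict_of_subset
      (Ioo_subset_Ioo_right hx.2) (coeFn_toL2w (μ := μ) (clamp g' hg')),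
      ae_restrict_mem measurableSet_Ioo] with y hy hyI
    rw [hy, clamp_apply hg' ⟨hyI.1.le, hyI.2.le.trans hx.2⟩]
  rw [this, intervalIntegral.integral_eq_sub_of_hasDerivAt (fun y _ => h y)
    (hg'.intervalIntegrable _ _)]
  ring

/-- On `[-1, 1]` both factors coincide with absolutely continuous functions whose derivatives are
`f` and `g` almost everywhere, so integration by parts for absolutely continuous functions applies.
-/
theorem IsPrimitive.mul {F G : ℝ →ᵇ ℝ} {f g : L2w μ} (hF : IsPrimitive F f)
    (hG : IsPrimitive G g) : IsPrimitive (F * G) (mulL2w G f + mulL2w F g) := by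
  intro x hx
  have aux : ∀ (H : ℝ →ᵇ ℝ) (h : L2w μ), IsPrimitive H h →
      (∀ y ∈ Icc (-1 : ℝ) 1, H y = H (-1) + ∫ ξ in (-1 : ℝ)..y, h ξ) ∧
      AbsolutelyContinuousOnInterval (fun y => H (-1) + ∫ ξ in (-1 : ℝ)..y, h ξ) (-1) 1 ∧
      ∀ᵐ y, y ∈ Icc (-1 : ℝ) 1 →
        deriv (fun y => H (-1) + ∫ ξ in (-1 : ℝ)..y, h ξ) y = h y := by
    intro H h hH
    refine ⟨fun y hy => by rw [hH y hy, primitive_eq_intervalIntegral _ hy], ?_, ?_⟩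
    · have h1 : AbsolutelyContinuousOnInterval (fun _ : ℝ => H (-1)) (-1) 1 :=
        contDiffOn_const.absolutelyContinuousOnInterval
      exact h1.add
        ((intervalIntegrable_L2w h).absolutelyContinuousOnInterval_intervalIntegral (by simp))
    · filter_upwards [(intervalIntegrable_L2w h).ae_hasDerivAt_integral] with y hy hyI
      rw [uIcc_of_le (by norm_num)] at hy
      exact ((hy hyI (-1) left_mem).const_add _).deriv
  obtain ⟨hF1, hF2, hF3⟩ := aux F f hF
  obtain ⟨hG1, hG2, hG3⟩ := aux G g hG
  have hsub : uIcc (-1 : ℝ) x ⊆ uIcc (-1 : ℝ) 1 := by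
    rw [uIcc_of_le hx.1, uIcc_of_le (by norm_num)]
    exact Icc_subset_Icc_right hx.2
  have key := (hF2.mono hsub).integral_deriv_mul_eq_sub (hG2.mono hsub)
  rw [← hF1 x hx, ← hF1 _ left_mem, ← hG1 x hx, ← hG1 _ left_mem] at key
  rw [BoundedContinuousFunction.mul_apply, BoundedContinuousFunction.mul_apply,
    primitive_eq_intervalIntegral _ hx]
  refine eq_add_of_sub_eq' (key.symm.trans ?_)
  rw [intervalIntegral.integral_of_le hx.1, intervalIntegral.integral_of_le hx.1,
    integral_Ioc_eq_integral_Ioo, integral_Ioc_eq_integral_Ioo]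
  refine integral_congr_ae ?_
  have hs : Ioo (-1 : ℝ) x ⊆ Ioo (-1 : ℝ) 1 := Ioo_subset_Ioo_right hx.2
  filter_upwards [ae_restrict_of_ae hF3, ae_restrict_of_ae hG3,
    ae_restrict_of_ae_restrict_of_subset hs
      (ae_jacobiMeasure (Lp.coeFn_add (mulL2w G f) (mulL2w F g))),
    ae_restrict_of_ae_restrict_of_subset hs (coeFn_mulL2w G f),
    ae_restrict_of_ae_restrict_of_subset hs (coeFn_mulL2w F g),
    ae_restrict_mem measurableSet_Ioo] with y h1 h2 h3 h4 h5 hy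
  have hyI : y ∈ Icc (-1 : ℝ) 1 := Ioo_subset_Icc_self (hs hy)
  rw [h1 hyI, h2 hyI, ← hF1 y hyI, ← hG1 y hyI, h3, Pi.add_apply, h4, h5]
  ring

/-- The pairing `∫ f ψ` of `f ∈ L²_w` with a continuous function. -/
theorem setIntegral_mul_eq_primitive (f : L2w μ) {ψ : ℝ → ℝ} (hψ : Continuous ψ) :
    ∫ x in Ioo (-1 : ℝ) 1, f x * ψ x = primitive (mulL2w (clamp ψ hψ) f) 1 := by
  rw [primitive_apply, inter_eq_left.2 fun x hx => hx.2.le]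
  refine integral_congr_ae ?_
  filter_upwards [coeFn_mulL2w (clamp ψ hψ) f, ae_restrict_mem measurableSet_Ioo] with x h1 h2
  rw [h1, clamp_apply hψ (Ioo_subset_Icc_self h2), mul_comm]

/-- The product rule for `F * φ`, evaluated at the right endpoint: both boundary terms vanish since
`φ` is supported inside. -/
theorem IsPrimitive.hasWeakDeriv {F : ℝ →ᵇ ℝ} {f : L2w μ} (hF : IsPrimitive F f) :
    HasWeakDeriv (toL2w F : L2w μ) f := by
  intro φ hφ hc hs
  have hφ' : Continuous (deriv φ) := hφ.continuous_deriv (by simp)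
  have hP := hF.mul (isPrimitive_clamp (μ := μ) hφ' fun x =>
    ((hφ.differentiable (by simp)) x).hasDerivAt) 1 right_mem
  rw [BoundedContinuousFunction.mul_apply, BoundedContinuousFunction.mul_apply,
    clamp_apply _ left_mem, clamp_apply _ right_mem,
    eq_zero_of_tsupport_subset hs (x := 1) (by simp),
    eq_zero_of_tsupport_subset hs (x := -1) (by simp), map_add,
    BoundedContinuousFunction.add_apply] at hP
  have hcomm : (mulL2w F (toL2w (clamp (deriv φ) hφ')) : L2w μ) =
      mulL2w (clamp (deriv φ) hφ') (toL2w F) := by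
    refine L2w_ext ?_
    filter_upwards [coeFn_mulL2w (μ := μ) F (toL2w (clamp (deriv φ) hφ')),
      coeFn_mulL2w (μ := μ) (clamp (deriv φ) hφ') (toL2w F), coeFn_toL2w (μ := μ) F,
      coeFn_toL2w (μ := μ) (clamp (deriv φ) hφ')] with x h1 h2 h3 h4
    rw [h1, h2, h3, h4, mul_comm]
  rw [setIntegral_mul_eq_primitive _ hφ', setIntegral_mul_eq_primitive _ hφ.continuous, ← hcomm]
  linarith

/-- The continuous representative of a function `f₀` with weak derivative `f₁`. -/
def representative : L2w μ × L2w μ →L[ℝ] (ℝ →ᵇ ℝ) :=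
  (ContinuousLinearMap.toSpanSingleton ℝ (1 : ℝ →ᵇ ℝ)).comp
    -- The additive constant is the mean of `f₀ - primitive f₁` over an interval of length 2, which
    -- makes it a bounded linear functional of the pair.
    ((1 / 2 : ℝ) • ((BoundedContinuousFunction.evalCLM ℝ (1 : ℝ)).comp
      (primitive.comp (ContinuousLinearMap.fst ℝ _ _ -
        toL2w.comp (primitive.comp (ContinuousLinearMap.snd ℝ _ _)))))) +
  primitive.comp (ContinuousLinearMap.snd ℝ _ _)

theorem representative_apply (f₀ f₁ : L2w μ) :
    representative (f₀, f₁) =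
      (1 / 2 * primitive (f₀ - toL2w (primitive f₁)) 1) • (1 : ℝ →ᵇ ℝ) + primitive f₁ := rfl

theorem isPrimitive_representative (f₀ f₁ : L2w μ) :
    IsPrimitive (representative (f₀, f₁)) f₁ := by
  have := (isPrimitive_const (μ := μ) (1 / 2 * primitive (f₀ - toL2w (primitive f₁)) 1)).add
    (isPrimitive_primitive f₁)
  rwa [zero_add] at this

/-- The difference `f₀ - primitive f₁` has zero weak derivative, so it is constant and equal to its
mean. -/
theorem toL2w_representative {f₀ f₁ : L2w μ} (h : HasWeakDeriv f₀ f₁) :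
    toL2w (representative (f₀, f₁)) = f₀ := by
  have hsub : ∀ᵐ x ∂volume.restrict (Ioo (-1 : ℝ) 1),
      (f₀ - toL2w (primitive f₁) : L2w μ) x = f₀ x - (toL2w (primitive f₁) : L2w μ) x :=
    ae_jacobiMeasure (Lp.coeFn_sub _ _)
  obtain ⟨c, hc⟩ : ∃ c, ∀ᵐ x ∂volume.restrict (Ioo (-1 : ℝ) 1),
      (f₀ - toL2w (primitive f₁) : L2w μ) x = c := by
    refine exists_ae_eq_const (integrableOn_L2w _) fun φ hφ hφc hφs => ?_
    have hφ' : Continuous (deriv φ) := hφ.continuous_deriv (by simp)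
    have hs' := (tsupport_deriv_subset (f := φ)).trans hφs
    have e : ∫ x in Ioo (-1 : ℝ) 1, (f₀ - toL2w (primitive f₁) : L2w μ) x * deriv φ x =
        (∫ x in Ioo (-1 : ℝ) 1, f₀ x * deriv φ x) -
          ∫ x in Ioo (-1 : ℝ) 1, (toL2w (primitive f₁) : L2w μ) x * deriv φ x := by
      rw [← integral_sub (integrableOn_mul f₀ hφ' hφc.deriv hs')
        (integrableOn_mul _ hφ' hφc.deriv hs')]
      refine integral_congr_ae ?_
      filter_upwards [hsub] with x hx
      rw [hx, sub_mul]
    rw [e, h φ hφ hφc hφs, (isPrimitive_primitive f₁).hasWeakDeriv φ hφ hφc hφs, sub_self]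
  have hI : primitive (f₀ - toL2w (primitive f₁)) 1 = 2 * c := by
    rw [primitive_apply, inter_eq_left.2 fun x hx => hx.2.le, integral_congr_ae hc]
    simp; norm_num
  refine L2w_ext ?_
  filter_upwards [hsub, hc, coeFn_toL2w (μ := μ) (primitive f₁),
    coeFn_toL2w (μ := μ) (representative (f₀, f₁))] with x h1 h2 h3 h4
  rw [h4, representative_apply, hI]
  simp only [BoundedContinuousFunction.add_apply, BoundedContinuousFunction.coe_smul,
    BoundedContinuousFunction.coe_one, Pi.one_apply, smul_eq_mul]
  linarith

/-- The weak derivative of order `j`, as a bounded operator `H^k_w → L²_w`. -/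
def component {k : ℕ} (j : Fin (k + 1)) : Hw μ k →L[ℝ] L2w μ :=
  (PiLp.proj 2 (fun _ : Fin (k + 1) => L2w μ) j).comp (weightedSobolev μ k).subtypeL

theorem wderiv_eq {k : ℕ} (j : Fin (k + 1)) (f : Hw μ k) : wderiv j f = component j f := rfl

theorem val_eq {k : ℕ} (f : Hw μ k) : val f = component 0 f := rfl

theorem hasWeakDeriv_component {k : ℕ} (f : Hw μ k) (j : Fin k) :
    HasWeakDeriv (component j.castSucc f) (component j.succ f) := f.2 j

/-- A bounded operator into `H^k_w`, given by the derivatives of its values. -/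
def liftHw {E : Type*} [NormedAddCommGroup E] [NormedSpace ℝ E] {k : ℕ}
    (A : Fin (k + 1) → E →L[ℝ] L2w μ)
    (hA : ∀ e (j : Fin k), HasWeakDeriv (A j.castSucc e) (A j.succ e)) : E →L[ℝ] Hw μ k :=
  (((PiLp.continuousLinearEquiv 2 ℝ fun _ : Fin (k + 1) => L2w μ).symm :
    (Fin (k + 1) → L2w μ) →L[ℝ] PiLp 2 fun _ : Fin (k + 1) => L2w μ).comp (ContinuousLinearMap.pi A)).codRestrict
    (weightedSobolev μ k) fun e j => hA e j

theorem Hw_ext_component {k : ℕ} {f g : Hw μ k} (h : ∀ j, component j f = component j g) :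
    f = g := by
  refine Subtype.ext (PiLp.ext fun j => h j)

/-- Uniqueness of weak derivatives propagates equality from each order to the next. Identities in
`H^k_w` can thus be checked on the underlying functions alone. -/
theorem Hw_ext {k : ℕ} {f g : Hw μ k} (h : component 0 f = component 0 g) : f = g := by
  refine Hw_ext_component fun j => ?_
  induction j using Fin.induction with
  | zero => exact h
  | succ j ih =>
    refine HasWeakDeriv.unique (hasWeakDeriv_component f j) ?_
    rw [ih]
    exact hasWeakDeriv_component g j

/-- For each test function the defining condition equates two continuous functionals. Closedness
yields the completeness that Picard–Lindelöf and Bochner integration require. -/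
theorem isClosed_weightedSobolev (k : ℕ) :
    IsClosed (weightedSobolev μ k : Set (PiLp 2 fun _ : Fin (k + 1) => L2w μ)) := by
  have : (weightedSobolev μ k : Set (PiLp 2 fun _ : Fin (k + 1) => L2w μ)) =
      ⋂ (j : Fin k) (φ : ℝ → ℝ) (_ : ContDiff ℝ ∞ φ) (_ : HasCompactSupport φ)
        (_ : tsupport φ ⊆ Ioo (-1 : ℝ) 1),
        {f | ∫ x in Ioo (-1 : ℝ) 1, f j.castSucc x * deriv φ x =
          -∫ x in Ioo (-1 : ℝ) 1, f j.succ x * φ x} := by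
    ext f
    simp only [mem_iInter]
    rfl
  rw [this]
  refine isClosed_iInter fun j => isClosed_iInter fun φ => isClosed_iInter fun hφ =>
    isClosed_iInter fun _ => isClosed_iInter fun _ => ?_
  have hcont : ∀ (i : Fin (k + 1)) (ψ : ℝ → ℝ), Continuous ψ →
      Continuous fun f : PiLp 2 fun _ : Fin (k + 1) => L2w μ =>
        ∫ x in Ioo (-1 : ℝ) 1, f i x * ψ x := fun i ψ hψ => by
    simp only [setIntegral_mul_eq_primitive _ hψ]
    exact ((BoundedContinuousFunction.evalCLM ℝ (1 : ℝ)).comp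
      (primitive.comp ((mulL2w (clamp ψ hψ)).comp
        (PiLp.proj 2 (𝕜 := ℝ) (fun _ : Fin (k + 1) => L2w μ) i)))).continuous
  exact isClosed_eq (hcont _ _ (hφ.continuous_deriv (by simp))) (hcont _ _ hφ.continuous).neg

instance completeSpace_Hw (k : ℕ) : CompleteSpace (Hw μ k) :=
  (isClosed_weightedSobolev k).completeSpace_coe

end

end BonaSmith

/-! ### The Green operator, its gain of one derivative, and the algebra `H¹_w`. -/

namespace BonaSmith

noncomputable section

set_option linter.unusedSectionVars false

open Filter Topology BoundedContinuousFunction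

variable {μ : ℝ} [Fact (-1 < μ)] [Fact (μ < 1)]

theorem mulL2w_toL2w (F G : ℝ →ᵇ ℝ) : mulL2w F (toL2w G : L2w μ) = toL2w (F * G) := by
  refine L2w_ext ?_
  filter_upwards [coeFn_mulL2w (μ := μ) F (toL2w G), coeFn_toL2w (μ := μ) G,
    coeFn_toL2w (μ := μ) (F * G)] with x h1 h2 h3
  rw [h1, h2, h3, BoundedContinuousFunction.mul_apply]

theorem mulL2w_mulL2w (F G : ℝ →ᵇ ℝ) (f : L2w μ) :
    mulL2w F (mulL2w G f) = mulL2w (F * G) f := by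
  refine L2w_ext ?_
  filter_upwards [coeFn_mulL2w F (mulL2w G f), coeFn_mulL2w G f,
    coeFn_mulL2w (F * G) f] with x h1 h2 h3
  rw [h1, h2, h3, BoundedContinuousFunction.mul_apply, mul_assoc]

theorem one_mulL2w (f : L2w μ) : mulL2w 1 f = f := by
  refine L2w_ext ?_
  filter_upwards [coeFn_mulL2w 1 f] with x h1
  rw [h1, BoundedContinuousFunction.coe_one, Pi.one_apply, one_mul]

/-! ### The hyperbolic functions in the Green function -/

theorem continuous_w₁ (b : ℝ) : Continuous (w₁ b) := by unfold w₁; fun_prop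

theorem continuous_w₂ (b : ℝ) : Continuous (w₂ b) := by unfold w₂; fun_prop

theorem continuous_cosh₁ (b : ℝ) : Continuous fun x => Real.cosh ((1 + x) / √b) := by fun_prop

theorem continuous_cosh₂ (b : ℝ) : Continuous fun x => Real.cosh ((1 - x) / √b) := by fun_prop

theorem hasDerivAt_w₁ (b x : ℝ) :
    HasDerivAt (w₁ b) ((√b)⁻¹ * Real.cosh ((1 + x) / √b)) x := by
  have h : HasDerivAt (fun x => (1 + x) / √b) ((√b)⁻¹) x := by
    simpa using ((hasDerivAt_id x).const_add 1).div_const (√b)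
  rw [mul_comm]
  exact h.sinh

theorem hasDerivAt_w₂ (b x : ℝ) :
    HasDerivAt (w₂ b) (-(√b)⁻¹ * Real.cosh ((1 - x) / √b)) x := by
  have h : HasDerivAt (fun x => (1 - x) / √b) (-(√b)⁻¹) x := by
    simpa [neg_div] using ((hasDerivAt_id x).const_sub 1).div_const (√b)
  rw [mul_comm]
  exact h.sinh

theorem hasDerivAt_cosh₁ (b x : ℝ) :
    HasDerivAt (fun x => Real.cosh ((1 + x) / √b)) ((√b)⁻¹ * w₁ b x) x := by
  have h : HasDerivAt (fun x => (1 + x) / √b) ((√b)⁻¹) x := by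
    simpa using ((hasDerivAt_id x).const_add 1).div_const (√b)
  rw [mul_comm]
  exact h.cosh

theorem hasDerivAt_cosh₂ (b x : ℝ) :
    HasDerivAt (fun x => Real.cosh ((1 - x) / √b)) (-(√b)⁻¹ * w₂ b x) x := by
  have h : HasDerivAt (fun x => (1 - x) / √b) (-(√b)⁻¹) x := by
    simpa [neg_div] using ((hasDerivAt_id x).const_sub 1).div_const (√b)
  rw [mul_comm]
  exact h.cosh

/-- The addition formula for `sinh`. Up to the factor `-1/√b` this is the Wronskian, and it is what
makes the local term in `(A_D f)'` exactly `f / b`. -/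
theorem w₂_mul_cosh_add (b x : ℝ) :
    w₂ b x * Real.cosh ((1 + x) / √b) + w₁ b x * Real.cosh ((1 - x) / √b) =
      Real.sinh (2 / √b) := by
  have : 2 / √b = (1 - x) / √b + (1 + x) / √b := by ring
  rw [this, Real.sinh_add, w₁, w₂]
  ring

theorem sinh_pos {b : ℝ} (hb : 0 < b) : 0 < Real.sinh (2 / √b) := by
  rw [Real.sinh_pos_iff]; positivity

/-- `w₁` on `[-1, 1]`. -/
def W₁ (b : ℝ) : ℝ →ᵇ ℝ := clamp (w₁ b) (continuous_w₁ b)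

/-- `w₂` on `[-1, 1]`. -/
def W₂ (b : ℝ) : ℝ →ᵇ ℝ := clamp (w₂ b) (continuous_w₂ b)

/-- `cosh ((1 + x) / √b)` on `[-1, 1]`. -/
def K₁ (b : ℝ) : ℝ →ᵇ ℝ := clamp _ (continuous_cosh₁ b)

/-- `cosh ((1 - x) / √b)` on `[-1, 1]`. -/
def K₂ (b : ℝ) : ℝ →ᵇ ℝ := clamp _ (continuous_cosh₂ b)

theorem W₂_mul_K₁_add (b : ℝ) : W₂ b * K₁ b + W₁ b * K₂ b = Real.sinh (2 / √b) • 1 := by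
  ext x
  refine (w₂_mul_cosh_add b (projIcc (-1 : ℝ) 1 (by norm_num) x)).trans ?_
  simp

theorem clamp_const_mul {g : ℝ → ℝ} (hg : Continuous g) (a : ℝ) :
    clamp (fun x => a * g x) (by fun_prop) = a • clamp g hg := rfl

theorem isPrimitive_W₁ (b : ℝ) : IsPrimitive (W₁ b) ((√b)⁻¹ • toL2w (K₁ b) : L2w μ) := by
  rw [← map_smul, K₁, ← clamp_const_mul]
  exact isPrimitive_clamp _ (hasDerivAt_w₁ b)

theorem isPrimitive_W₂ (b : ℝ) : IsPrimitive (W₂ b) (-(√b)⁻¹ • toL2w (K₂ b) : L2w μ) := by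
  rw [← map_smul, K₂, ← clamp_const_mul]
  exact isPrimitive_clamp _ (hasDerivAt_w₂ b)

theorem isPrimitive_K₁ (b : ℝ) : IsPrimitive (K₁ b) ((√b)⁻¹ • toL2w (W₁ b) : L2w μ) := by
  rw [← map_smul, W₁, ← clamp_const_mul (continuous_w₁ b)]
  exact isPrimitive_clamp ((continuous_w₁ b).const_mul _) (hasDerivAt_cosh₁ b)

theorem isPrimitive_K₂ (b : ℝ) : IsPrimitive (K₂ b) (-(√b)⁻¹ • toL2w (W₂ b) : L2w μ) := by
  rw [← map_smul, W₂, ← clamp_const_mul (continuous_w₂ b)]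
  exact isPrimitive_clamp ((continuous_w₂ b).const_mul _) (hasDerivAt_cosh₂ b)

/-! ### The operator `A_D` -/

/-- The operator `A_D`, with values in the bounded continuous functions. -/
def greenOp (b : ℝ) : L2w μ →L[ℝ] (ℝ →ᵇ ℝ) :=
  (b * Real.sinh (2 / √b))⁻¹ •
    ((ContinuousLinearMap.mul ℝ (ℝ →ᵇ ℝ) (W₂ b)).comp (primitive.comp (mulL2w (K₁ b))) +
      (ContinuousLinearMap.mul ℝ (ℝ →ᵇ ℝ) (W₁ b)).comp (primitive.comp (mulL2w (K₂ b))) -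
      -- The kernel involves an integral from `x` to `1`, written as the total minus the primitive;
      -- this is the contribution of the total.
      (ContinuousLinearMap.toSpanSingleton ℝ (W₁ b)).comp
        ((BoundedContinuousFunction.evalCLM ℝ (1 : ℝ)).comp (primitive.comp (mulL2w (K₂ b)))))

theorem greenOp_eq (b : ℝ) (f : L2w μ) : greenOp b f = (b * Real.sinh (2 / √b))⁻¹ •
    (W₂ b * primitive (mulL2w (K₁ b) f) + W₁ b * primitive (mulL2w (K₂ b) f) -
      primitive (mulL2w (K₂ b) f) 1 • W₁ b) := rfl

/-- The regular part `(A_D f)' - f / b` of the derivative of `A_D f`. -/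
def greenDerivOp (b : ℝ) : L2w μ →L[ℝ] (ℝ →ᵇ ℝ) :=
  ((b * Real.sinh (2 / √b))⁻¹ * (√b)⁻¹) •
    ((ContinuousLinearMap.mul ℝ (ℝ →ᵇ ℝ) (K₁ b)).comp (primitive.comp (mulL2w (K₂ b))) -
      (ContinuousLinearMap.mul ℝ (ℝ →ᵇ ℝ) (K₂ b)).comp (primitive.comp (mulL2w (K₁ b))) -
      (ContinuousLinearMap.toSpanSingleton ℝ (K₁ b)).comp
        ((BoundedContinuousFunction.evalCLM ℝ (1 : ℝ)).comp (primitive.comp (mulL2w (K₂ b)))))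

theorem greenDerivOp_eq (b : ℝ) (f : L2w μ) :
    greenDerivOp b f = ((b * Real.sinh (2 / √b))⁻¹ * (√b)⁻¹) •
    (K₁ b * primitive (mulL2w (K₂ b) f) - K₂ b * primitive (mulL2w (K₁ b) f) -
      primitive (mulL2w (K₂ b) f) 1 • K₁ b) := rfl

/-- By the product rule, differentiating the primitives gives `(W₂ K₁ + W₁ K₂) f / (b α) = f / b`,
and differentiating the hyperbolic factors gives `greenDerivOp`. -/
theorem isPrimitive_greenOp {b : ℝ} (hb : 0 < b) (f : L2w μ) :
    IsPrimitive (greenOp b f) (toL2w (greenDerivOp b f) + b⁻¹ • f) := by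
  rw [greenOp_eq]
  convert! ((((isPrimitive_W₂ (μ := μ) b).mul (isPrimitive_primitive (mulL2w (K₁ b) f))).add
    ((isPrimitive_W₁ b).mul (isPrimitive_primitive (mulL2w (K₂ b) f)))).sub
    ((isPrimitive_W₁ b).smul (primitive (mulL2w (K₂ b) f) 1))).smul
    (b * Real.sinh (2 / √b))⁻¹ using 1
  have hs := (sinh_pos hb).ne'
  have key : mulL2w (W₂ b) (mulL2w (K₁ b) f) + mulL2w (W₁ b) (mulL2w (K₂ b) f) =
      Real.sinh (2 / √b) • f := by
    rw [mulL2w_mulL2w, mulL2w_mulL2w, ← _root_.add_apply, ← map_add,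
      W₂_mul_K₁_add, map_smul, _root_.smul_apply, one_mulL2w]
  have hb' : b⁻¹ • f = (b * Real.sinh (2 / √b))⁻¹ • (mulL2w (W₂ b) (mulL2w (K₁ b) f) +
      mulL2w (W₁ b) (mulL2w (K₂ b) f)) := by
    rw [key, smul_smul]; congr 1; field_simp
  rw [hb', greenDerivOp_eq]
  simp only [map_smul, map_sub, mulL2w_toL2w, mul_comm _ (K₁ b), mul_comm _ (K₂ b)]
  module

/-- Here the terms from differentiating the primitives are `K₁ K₂ f - K₂ K₁ f` and cancel; only the
hyperbolic factors contribute, and they rebuild `greenOp`. The regular part of `(A_D f)'` is thus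
smoother than `f`. -/
theorem isPrimitive_greenDerivOp {b : ℝ} (hb : 0 < b) (f : L2w μ) :
    IsPrimitive (greenDerivOp b f) (b⁻¹ • toL2w (greenOp b f) : L2w μ) := by
  rw [greenDerivOp_eq]
  convert! ((((isPrimitive_K₁ (μ := μ) b).mul (isPrimitive_primitive (mulL2w (K₂ b) f))).sub
    ((isPrimitive_K₂ b).mul (isPrimitive_primitive (mulL2w (K₁ b) f)))).sub
    ((isPrimitive_K₁ b).smul (primitive (mulL2w (K₂ b) f) 1))).smul
    ((b * Real.sinh (2 / √b))⁻¹ * (√b)⁻¹) using 1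
  have hb' : b⁻¹ = (√b)⁻¹ * (√b)⁻¹ := by
    rw [← mul_inv, Real.mul_self_sqrt hb.le]
  rw [hb', greenOp_eq]
  simp only [map_smul, map_sub, map_add, mulL2w_toL2w, mulL2w_mulL2w, mul_comm _ (W₁ b),
    mul_comm _ (W₂ b), mul_comm (K₂ b) (K₁ b)]
  module

theorem wronskian_eq (b x : ℝ) : wronskian b x = -((√b)⁻¹ * Real.sinh (2 / √b)) := by
  rw [wronskian, (hasDerivAt_w₁ b x).deriv, (hasDerivAt_w₂ b x).deriv, ← w₂_mul_cosh_add b x]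
  ring

theorem green_const {b : ℝ} (hb : 0 < b) (x : ℝ) :
    -(1 / (b * wronskian b x)) * (√b)⁻¹ = (b * Real.sinh (2 / √b))⁻¹ := by
  have hs := (sinh_pos hb).ne'
  have hb' := (Real.sqrt_pos.2 hb).ne'
  rw [wronskian_eq]
  field_simp

theorem deriv_green_of_lt {b : ℝ} (hb : 0 < b) {x ξ : ℝ} (h : ξ < x) :
    deriv (fun ξ' => green b x ξ') ξ =
      (b * Real.sinh (2 / √b))⁻¹ * w₂ b x * Real.cosh ((1 + ξ) / √b) := by
  have he : (fun ξ' => green b x ξ') =ᶠ[𝓝 ξ]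
      fun ξ' => -(1 / (b * wronskian b x)) * (w₁ b ξ' * w₂ b x) := by
    filter_upwards [Iio_mem_nhds h] with y hy
    rw [green, if_pos (le_of_lt hy)]
  rw [he.deriv_eq, (((hasDerivAt_w₁ b ξ).mul_const _).const_mul _).deriv, ← green_const hb x]
  ring

theorem deriv_green_of_gt {b : ℝ} (hb : 0 < b) {x ξ : ℝ} (h : x < ξ) :
    deriv (fun ξ' => green b x ξ') ξ =
      -((b * Real.sinh (2 / √b))⁻¹ * w₁ b x) * Real.cosh ((1 - ξ) / √b) := by
  have he : (fun ξ' => green b x ξ') =ᶠ[𝓝 ξ]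
      fun ξ' => -(1 / (b * wronskian b x)) * (w₁ b x * w₂ b ξ') := by
    filter_upwards [Ioi_mem_nhds h] with y hy
    rw [green, if_neg (not_le_of_gt hy)]
  rw [he.deriv_eq, (((hasDerivAt_w₂ b ξ).const_mul _).const_mul _).deriv, ← green_const hb x]
  ring

theorem solOp_congr (b : ℝ) {f g : ℝ → ℝ}
    (h : ∀ᵐ x ∂volume.restrict (Ioo (-1 : ℝ) 1), f x = g x) : solOp b f = solOp b g := by
  funext x
  rw [solOp, solOp, intervalIntegral.integral_of_le (by norm_num),
    intervalIntegral.integral_of_le (by norm_num), integral_Ioc_eq_integral_Ioo,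
    integral_Ioc_eq_integral_Ioo]
  refine integral_congr_ae ?_
  filter_upwards [h] with y hy
  rw [hy]

/-- The integral is split at `x`, where the kernel changes formula. The Green function has a kink at
`ξ = x`, but the value of `deriv` at this single point does not affect the integral. -/
theorem solOp_eq_greenOp {b : ℝ} (hb : 0 < b) (f : L2w μ) {x : ℝ} (hx : x ∈ Ioo (-1 : ℝ) 1) :
    solOp b f x = greenOp b f x := by
  have hxI := Ioo_subset_Icc_self hx
  set k := (b * Real.sinh (2 / √b))⁻¹ with hk
  have hl : ∀ᵐ ξ ∂volume.restrict (Ioc (-1 : ℝ) x),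
      deriv (fun ξ' => green b x ξ') ξ * f ξ = k * w₂ b x * (mulL2w (K₁ b) f : L2w μ) ξ := by
    rw [← restrict_Ioo_eq_restrict_Ioc]
    filter_upwards [ae_restrict_of_ae_restrict_of_subset (Ioo_subset_Ioo_right hx.2.le)
      (coeFn_mulL2w (K₁ b) f), ae_restrict_mem measurableSet_Ioo] with ξ h1 h2
    rw [deriv_green_of_lt hb h2.2, h1, K₁, clamp_apply _ ⟨h2.1.le, h2.2.le.trans hx.2.le⟩]
    ring
  have hr : ∀ᵐ ξ ∂volume.restrict (Ioc x 1),
      deriv (fun ξ' => green b x ξ') ξ * f ξ = -(k * w₁ b x) * (mulL2w (K₂ b) f : L2w μ) ξ := by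
    rw [← restrict_Ioo_eq_restrict_Ioc]
    filter_upwards [ae_restrict_of_ae_restrict_of_subset (Ioo_subset_Ioo_left hx.1.le)
      (coeFn_mulL2w (K₂ b) f), ae_restrict_mem measurableSet_Ioo] with ξ h1 h2
    rw [deriv_green_of_gt hb h2.1, h1, K₂, clamp_apply _ ⟨hx.1.le.trans h2.1.le, h2.2.le⟩]
    ring
  have hil : IntervalIntegrable (fun ξ => k * w₂ b x * (mulL2w (K₁ b) f : L2w μ) ξ)
      volume (-1) x := ((intervalIntegrable_L2w (mulL2w (K₁ b) f)).mono_set (by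
        rw [uIcc_of_le hxI.1, uIcc_of_le (by norm_num)]
        exact Icc_subset_Icc_right hx.2.le)).const_mul _
  have hir' : IntervalIntegrable (mulL2w (K₂ b) f : L2w μ) volume x 1 :=
    (intervalIntegrable_L2w (mulL2w (K₂ b) f)).mono_set (by
        rw [uIcc_of_le hxI.2, uIcc_of_le (by norm_num)]
        exact Icc_subset_Icc_left hx.1.le)
  have hil2 : IntervalIntegrable (mulL2w (K₂ b) f : L2w μ) volume (-1) x :=
    (intervalIntegrable_L2w (mulL2w (K₂ b) f)).mono_set (by
        rw [uIcc_of_le hxI.1, uIcc_of_le (by norm_num)]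
        exact Icc_subset_Icc_right hx.2.le)
  have hir : IntervalIntegrable (fun ξ => -(k * w₁ b x) * (mulL2w (K₂ b) f : L2w μ) ξ)
      volume x 1 := hir'.const_mul _
  rw [solOp, ← intervalIntegral.integral_add_adjacent_intervals
    (hil.congr_ae (by rw [uIoc_of_le hxI.1]; filter_upwards [hl] with ξ h using h.symm))
    (hir.congr_ae (by rw [uIoc_of_le hxI.2]; filter_upwards [hr] with ξ h using h.symm)),
    intervalIntegral.integral_of_le hxI.1, intervalIntegral.integral_of_le hxI.2,
    integral_congr_ae hl, integral_congr_ae hr, ← intervalIntegral.integral_of_le hxI.1,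
    ← intervalIntegral.integral_of_le hxI.2, intervalIntegral.integral_const_mul,
    intervalIntegral.integral_const_mul, greenOp_eq]
  have h1 := intervalIntegral.integral_add_adjacent_intervals hil2 hir'
  rw [← primitive_eq_intervalIntegral _ hxI, ← primitive_eq_intervalIntegral _ right_mem] at h1
  rw [← primitive_eq_intervalIntegral _ hxI, ← hk]
  simp only [BoundedContinuousFunction.coe_smul, BoundedContinuousFunction.add_apply,
    BoundedContinuousFunction.sub_apply, BoundedContinuousFunction.mul_apply, smul_eq_mul]
  rw [W₁, W₂, clamp_apply _ hxI, clamp_apply _ hxI, ← h1]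
  ring

/-- `A_D` as a bounded operator `L²_w → H¹_w`. -/
def greenL2w {b : ℝ} (hb : 0 < b) : L2w μ →L[ℝ] Hw μ 1 :=
  liftHw ![toL2w.comp (greenOp b),
      toL2w.comp (greenDerivOp b) + b⁻¹ • ContinuousLinearMap.id ℝ (L2w μ)] fun f j => by
    rw [Fin.fin_one_eq_zero j]
    exact (isPrimitive_greenOp hb f).hasWeakDeriv

/-- The continuous representative of an element of `H¹_w`. -/
def repHw : Hw μ 1 →L[ℝ] (ℝ →ᵇ ℝ) :=
  representative.comp ((component 0).prod (component 1))

theorem isPrimitive_repHw (f : Hw μ 1) : IsPrimitive (repHw f) (component 1 f) :=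
  isPrimitive_representative _ _

theorem toL2w_repHw (f : Hw μ 1) : toL2w (repHw f) = component 0 f :=
  toL2w_representative (hasWeakDeriv_component f 0)

/-- `A_D` as a bounded operator `H¹_w → H²_w`. -/
def greenHw {b : ℝ} (hb : 0 < b) : Hw μ 1 →L[ℝ] Hw μ 2 :=
  liftHw ![(toL2w.comp (greenOp b)).comp (component 0),
      (toL2w.comp (greenDerivOp b)).comp (component 0) + b⁻¹ • component 0,
      -- This is `(A_D f)'' = (A_D f + f') / b`.
      b⁻¹ • (toL2w.comp (greenOp b)).comp (component 0) + b⁻¹ • component 1] fun f j => by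
    fin_cases j
    · exact (isPrimitive_greenOp hb (component 0 f)).hasWeakDeriv
    · have h := ((isPrimitive_greenDerivOp hb (component 0 f)).add
        ((isPrimitive_repHw f).smul b⁻¹)).hasWeakDeriv
      rw [map_add, map_smul, toL2w_repHw] at h
      exact h

/-- The inclusion `H²_w → H¹_w`. -/
def inclHw : Hw μ 2 →L[ℝ] Hw μ 1 :=
  liftHw ![component 0, component 1] fun f j => by
    rw [Fin.fin_one_eq_zero j]
    exact hasWeakDeriv_component f 0

theorem component_inclHw (f : Hw μ 2) : component 0 (inclHw f) = component 0 f := rfl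

theorem norm_Hw_one_le (f : Hw μ 1) : ‖f‖ ≤ ‖component 0 f‖ + ‖component 1 f‖ := by
  have h : ‖f‖ ^ 2 = ‖component 0 f‖ ^ 2 + ‖component 1 f‖ ^ 2 := by
    have := PiLp.norm_sq_eq_of_L2 (fun _ : Fin 2 => L2w μ) f.1
    rw [Fin.sum_univ_two] at this
    exact this
  refine le_of_sq_le_sq ?_ (by positivity)
  nlinarith [norm_nonneg (component 0 f), norm_nonneg (component 1 f)]

/-- Multiplication `H¹_w × H¹_w → H¹_w`, as a bounded operator in the second factor. -/
def mulHw (f : Hw μ 1) : Hw μ 1 →L[ℝ] Hw μ 1 :=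
  liftHw ![(mulL2w (repHw f)).comp (component 0),
      (mulL2w.flip (component 1 f)).comp repHw + (mulL2w (repHw f)).comp (component 1)]
    fun g j => by
      rw [Fin.fin_one_eq_zero j]
      have h := ((isPrimitive_repHw f).mul (isPrimitive_repHw g)).hasWeakDeriv
      rw [← mulL2w_toL2w, toL2w_repHw] at h
      exact h

theorem component_zero_mulHw (f g : Hw μ 1) :
    component 0 (mulHw f g) = mulL2w (repHw f) (component 0 g) := rfl

theorem component_one_mulHw (f g : Hw μ 1) : component 1 (mulHw f g) =
    mulL2w (repHw g) (component 1 f) + mulL2w (repHw f) (component 1 g) := rfl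

theorem mulHw_sub_left (f f' g : Hw μ 1) : mulHw (f - f') g = mulHw f g - mulHw f' g :=
  Hw_ext (by simp only [map_sub, component_zero_mulHw, _root_.sub_apply])

/-- Elements of `H¹_w` are bounded by their norm through `repHw`, so each term of `fg` and of `f'g +
fg'` is a bounded function times an element of `L²_w`. -/
theorem exists_norm_mulHw_le :
    ∃ C, 0 ≤ C ∧ ∀ f g : Hw μ 1, ‖mulHw f g‖ ≤ C * ‖f‖ * ‖g‖ := by
  set m := ‖(mulL2w : (ℝ →ᵇ ℝ) →L[ℝ] L2w μ →L[ℝ] L2w μ)‖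
  set r := ‖(repHw : Hw μ 1 →L[ℝ] (ℝ →ᵇ ℝ))‖
  set c₀ := ‖(component 0 : Hw μ 1 →L[ℝ] L2w μ)‖
  set c₁ := ‖(component 1 : Hw μ 1 →L[ℝ] L2w μ)‖
  have key : ∀ (f g : Hw μ 1) (j : Fin 2) (c : ℝ), ‖component j g‖ ≤ c * ‖g‖ →
      ‖mulL2w (repHw f) (component j g)‖ ≤ m * r * c * (‖f‖ * ‖g‖) := fun f g j c hc =>
    calc ‖mulL2w (repHw f) (component j g)‖ ≤ m * ‖repHw f‖ * ‖component j g‖ :=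
          mulL2w.le_opNorm₂ _ _
      _ ≤ m * (r * ‖f‖) * (c * ‖g‖) := by
          gcongr
          exact repHw.le_opNorm f
      _ = _ := by ring
  refine ⟨m * r * (c₀ + 2 * c₁), by positivity, fun f g => ?_⟩
  have h0 := key f g 0 c₀ ((component 0).le_opNorm g)
  have h1 := key f g 1 c₁ ((component 1).le_opNorm g)
  have h2 := key g f 1 c₁ ((component 1).le_opNorm f)
  have h3 := norm_Hw_one_le (mulHw f g)
  rw [component_zero_mulHw, component_one_mulHw] at h3
  have h4 := norm_add_le (mulL2w (repHw g) (component 1 f)) (mulL2w (repHw f) (component 1 g))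
  calc _ ≤ m * r * c₀ * (‖f‖ * ‖g‖) + (m * r * c₁ * (‖g‖ * ‖f‖) + m * r * c₁ * (‖f‖ * ‖g‖)) := by
        linarith
    _ = _ := by ring

theorem component_mulHw (f g : Hw μ 1) :
    ∀ᵐ x ∂volume.restrict (Ioo (-1 : ℝ) 1),
      component 0 (mulHw f g) x = component 0 f x * component 0 g x := by
  rw [component_zero_mulHw]
  filter_upwards [coeFn_mulL2w (repHw f) (component 0 g), coeFn_toL2w (μ := μ) (repHw f)]
    with x h1 h2
  rw [h1, ← h2, toL2w_repHw]

end

end BonaSmith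

/-! ### The abstract equation `y = Y + ∫ B(y)` in a Banach space. -/

namespace BonaSmith

noncomputable section

set_option linter.unusedSectionVars false

open Filter Topology NNReal Metric

/-- Maps whose Lipschitz constant grows at most linearly. -/
def QuadLip {E F : Type*} [NormedAddCommGroup E] [NormedAddCommGroup F] (B : E → F) : Prop :=
  ∃ L, 0 ≤ L ∧ ∀ y z, ‖B y - B z‖ ≤ L * (1 + ‖y‖ + ‖z‖) * ‖y - z‖

section QuadLip

variable {E F G : Type*} [NormedAddCommGroup E] [NormedAddCommGroup F] [NormedAddCommGroup G]
  [NormedSpace ℝ E] [NormedSpace ℝ F] [NormedSpace ℝ G]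

theorem QuadLip.add {A B : E → F} (hA : QuadLip A) (hB : QuadLip B) :
    QuadLip fun y => A y + B y := by
  obtain ⟨L, hL0, hL⟩ := hA
  obtain ⟨L', hL0', hL'⟩ := hB
  refine ⟨L + L', by positivity, fun y z => ?_⟩
  rw [add_sub_add_comm, add_mul, add_mul]
  exact norm_add_le_of_le (hL y z) (hL' y z)

theorem QuadLip.prodMk {A : E → F} {B : E → G} (hA : QuadLip A) (hB : QuadLip B) :
    QuadLip fun y => (A y, B y) := by
  obtain ⟨L, hL0, hL⟩ := hA
  obtain ⟨L', hL0', hL'⟩ := hB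
  refine ⟨max L L', by positivity, fun y z => ?_⟩
  rw [Prod.mk_sub_mk, Prod.norm_mk]
  refine max_le ((hL y z).trans ?_) ((hL' y z).trans ?_)
  · gcongr; exact le_max_left _ _
  · gcongr; exact le_max_right _ _

theorem QuadLip.clm_comp (A : F →L[ℝ] G) {B : E → F} (hB : QuadLip B) :
    QuadLip fun y => A (B y) := by
  obtain ⟨L, hL0, hL⟩ := hB
  refine ⟨‖A‖ * L, by positivity, fun y z => ?_⟩
  rw [← map_sub, mul_assoc, mul_assoc, ← mul_assoc L]
  exact A.le_opNorm_of_le (hL y z)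

theorem ContinuousLinearMap.quadLip (A : E →L[ℝ] F) : QuadLip A := by
  refine ⟨‖A‖, norm_nonneg _, fun y z => ?_⟩
  rw [← map_sub, mul_assoc]
  refine A.le_opNorm_of_le ?_
  exact le_mul_of_one_le_left (norm_nonneg _) (by linarith [norm_nonneg y, norm_nonneg z])

theorem QuadLip.lipschitzOnWith {B : E → F} {L : ℝ}
    (hL : ∀ y z, ‖B y - B z‖ ≤ L * (1 + ‖y‖ + ‖z‖) * ‖y - z‖) (hL0 : 0 ≤ L) {r : ℝ} (hr : 0 ≤ r) :
    LipschitzOnWith (L * (1 + r + r)).toNNReal B (closedBall 0 r) := by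
  refine LipschitzOnWith.of_dist_le_mul fun y hy z hz => ?_
  rw [mem_closedBall_zero_iff] at hy hz
  rw [Real.coe_toNNReal _ (by positivity), dist_eq_norm, dist_eq_norm]
  refine (hL y z).trans ?_
  gcongr

theorem QuadLip.continuous {B : E → F} (hB : QuadLip B) : Continuous B := by
  obtain ⟨L, hL0, hL⟩ := hB
  rw [continuous_iff_continuousAt]
  intro y
  refine ((QuadLip.lipschitzOnWith hL hL0 (r := ‖y‖ + 1) (by positivity)).continuousOn).continuousAt
    ?_
  exact closedBall_mem_nhds_of_mem (by simp)

end QuadLip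

variable {E : Type*} [NormedAddCommGroup E] [NormedSpace ℝ E] [CompleteSpace E]

theorem hasDerivWithinAt_integral_of_continuous {g : ℝ → E} (hg : Continuous g) (t : ℝ)
    (s : Set ℝ) : HasDerivWithinAt (fun t => ∫ τ in (0 : ℝ)..t, g τ) (g t) s t :=
  (hg.integral_hasStrictDerivAt 0 t).hasDerivAt.hasDerivWithinAt

/-- Solutions of `y = Y + ∫ B(y)` are unique. -/
theorem volterra_unique {B : E → E} (hB : QuadLip B) {T : ℝ} (hT : 0 ≤ T) {Y : ℝ → E}
    {y z : C(Icc (0 : ℝ) T, E)}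
    (hy : ∀ t : Icc (0 : ℝ) T, y t = Y t + ∫ τ in (0 : ℝ)..t, B (IccExtend hT y τ))
    (hz : ∀ t : Icc (0 : ℝ) T, z t = Y t + ∫ τ in (0 : ℝ)..t, B (IccExtend hT z τ)) : y = z := by
  have hBc := hB.continuous
  obtain ⟨L, hL0, hL⟩ := hB
  -- A ball containing both given solutions: `B` is Lipschitz there, so uniqueness holds without any
  -- size restriction.
  set r := max ‖y‖ ‖z‖ with hr
  have hcont : ∀ x : C(Icc (0 : ℝ) T, E), Continuous fun τ => B (IccExtend hT x τ) := fun x =>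
    hBc.comp (continuous_IccExtend_iff.2 x.continuous)
  have hsub : ∀ x : C(Icc (0 : ℝ) T, E),
      (∀ t : Icc (0 : ℝ) T, x t = Y t + ∫ τ in (0 : ℝ)..t, B (IccExtend hT x τ)) →
      ‖x‖ ≤ r → ∀ t ∈ Ico 0 T,
        HasDerivWithinAt (fun t => ∫ τ in (0 : ℝ)..t, B (IccExtend hT x τ))
          ((fun t p => B (Y t + p)) t (∫ τ in (0 : ℝ)..t, B (IccExtend hT x τ))) (Ici t) t ∧
        (∫ τ in (0 : ℝ)..t, B (IccExtend hT x τ)) ∈ {p | Y t + p ∈ closedBall (0 : E) r} := by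
    intro x hx hxr t ht
    have htI : t ∈ Icc 0 T := Ico_subset_Icc_self ht
    have e : Y t + (∫ τ in (0 : ℝ)..t, B (IccExtend hT x τ)) = IccExtend hT x t := by
      rw [IccExtend_of_mem hT x htI, hx ⟨t, htI⟩]
    refine ⟨?_, ?_⟩
    · beta_reduce
      rw [e]
      exact hasDerivWithinAt_integral_of_continuous (hcont x) t _
    · rw [mem_ofPred_eq, e, mem_closedBall_zero_iff]
      exact (x.norm_coe_le_norm _).trans hxr
  -- Gronwall's argument is applied to the integrals `p = y - Y`, which are differentiable although
  -- `Y` is only continuous; they solve `p' = B(Y + p)` with `p(0) = 0`.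
  have h := ODE_solution_unique_of_mem_Icc_right
    (v := fun t p => B (Y t + p)) (s := fun t => {p | Y t + p ∈ closedBall (0 : E) r})
    (K := (L * (1 + r + r)).toNNReal) (a := 0) (b := T)
    (f := fun t => ∫ τ in (0 : ℝ)..t, B (IccExtend hT y τ))
    (g := fun t => ∫ τ in (0 : ℝ)..t, B (IccExtend hT z τ)) ?_
    (fun t _ => (hasDerivWithinAt_integral_of_continuous (hcont y) t _).continuousWithinAt)
    (fun t ht => (hsub y hy (le_max_left _ _) t ht).1)
    (fun t ht => (hsub y hy (le_max_left _ _) t ht).2)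
    (fun t _ => (hasDerivWithinAt_integral_of_continuous (hcont z) t _).continuousWithinAt)
    (fun t ht => (hsub z hz (le_max_right _ _) t ht).1)
    (fun t ht => (hsub z hz (le_max_right _ _) t ht).2) (by simp)
  · ext t
    rw [hy t, hz t]
    exact congrArg _ (h t.2)
  · intro t _
    refine LipschitzOnWith.of_dist_le_mul fun p hp q hq => ?_
    have := (QuadLip.lipschitzOnWith hL hL0 (r := r) (by positivity)).dist_le_mul _ hp _ hq
    rwa [dist_add_left] at this

/-- Solutions of `y = Y + ∫ B(y)` exist on a time interval that depends only on a bound for `Y`. -/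
theorem exists_volterra {B : E → E} (hB : QuadLip B) (h0 : B 0 = 0) {T : ℝ} (hT : 0 < T) {ρ : ℝ}
    (hρ : 0 ≤ ρ) :
    ∃ (T₀ : ℝ) (hT₀ : 0 < T₀) (C : ℝ), T₀ ≤ T ∧ ∀ Y : ℝ → E, ContinuousOn Y (Icc 0 T) →
      (∀ t ∈ Icc 0 T, ‖Y t‖ ≤ ρ) →
      ∃ y : C(Icc (0 : ℝ) T₀, E),
        (∀ t : Icc (0 : ℝ) T₀, y t = Y t + ∫ τ in (0 : ℝ)..t, B (IccExtend hT₀.le y τ)) ∧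
        ‖y‖ ≤ C ∧ ∀ t, ‖B (y t)‖ ≤ C := by
  obtain ⟨L, hL0, hL⟩ := hB
  -- `Y` stays in the ball of radius `ρ` and the correction `p` will stay in the unit ball. `N`
  -- bounds `B` on the sum of the two, using `B 0 = 0`.
  set r := ρ + 1 with hr
  have hr0 : 0 ≤ r := by positivity
  set N := L * (1 + r) * r with hN
  have hN0 : 0 ≤ N := by positivity
  have hBN : ∀ y ∈ closedBall (0 : E) r, ‖B y‖ ≤ N := fun y hy => by
    rw [mem_closedBall_zero_iff] at hy
    have := hL y 0
    rw [h0, sub_zero, sub_zero, norm_zero, add_zero] at this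
    refine this.trans ?_
    rw [hN]; gcongr
  have hBl := QuadLip.lipschitzOnWith hL hL0 hr0
  -- Over this time a field bounded by `N` cannot leave the unit ball; the `+ 1` avoids dividing by
  -- zero.
  set T₀ := min T (1 / (N + 1)) with hT₀
  have hT₀pos : 0 < T₀ := lt_min hT (by positivity)
  have hT₀T : T₀ ≤ T := min_le_left _ _
  have hNT : N * T₀ ≤ 1 := by
    calc N * T₀ ≤ (N + 1) * (1 / (N + 1)) := by
          gcongr
          · linarith
          · exact min_le_right _ _
      _ = 1 := by field_simp
  refine ⟨T₀, hT₀pos, r + N, hT₀T, fun Y hYc hYρ => ?_⟩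
  have hYc' : ContinuousOn Y (Icc 0 T₀) := hYc.mono (Icc_subset_Icc_right hT₀T)
  have hmaps : ∀ t ∈ Icc 0 T₀, ∀ p ∈ closedBall (0 : E) 1, Y t + p ∈ closedBall (0 : E) r := by
    intro t ht p hp
    rw [mem_closedBall_zero_iff] at hp ⊢
    exact norm_add_le_of_le (hYρ t ⟨ht.1, ht.2.trans hT₀T⟩) hp
  have hPL : IsPicardLindelof (fun t p => B (Y t + p)) (tmin := 0) (tmax := T₀)
      ⟨0, left_mem_Icc.2 hT₀pos.le⟩ (0 : E) 1 0 N.toNNReal (L * (1 + r + r)).toNNReal := by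
    refine ⟨fun t ht => ?_, fun p hp => ?_, fun t ht p hp => ?_, ?_⟩
    · refine LipschitzOnWith.of_dist_le_mul fun p hp q hq => ?_
      have := hBl.dist_le_mul _ (hmaps t ht p hp) _ (hmaps t ht q hq)
      rwa [dist_add_left] at this
    · exact hBl.continuousOn.comp (hYc'.add continuousOn_const) fun t ht => hmaps t ht p hp
    · rw [Real.coe_toNNReal _ hN0]
      exact hBN _ (hmaps t ht p hp)
    · simpa [hN0, hT₀pos.le] using hNT
  -- The fixed point of the Picard map is used directly, because the integral equation itself is
  -- what is wanted.
  obtain ⟨p, hp⟩ := ODE.FunSpace.exists_isFixedPt_next hPL (x := 0) (by simp)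
  have hp1 : ∀ t : Icc (0 : ℝ) T₀, Y t + p t ∈ closedBall (0 : E) r := fun t =>
    hmaps t t.2 _ (p.mem_closedBall hPL.mul_max_le)
  have hpeq : ∀ t : Icc (0 : ℝ) T₀,
      p t = ∫ τ in (0 : ℝ)..t, B (Y τ + p.compProj τ) := fun t => by
    have h := ODE.FunSpace.next_apply hPL (x := 0) (by simp) p (t := t)
    rw [hp] at h
    simpa using h
  let y : C(Icc (0 : ℝ) T₀, E) := ⟨fun t => Y t + p t,
    (continuousOn_iff_continuous_domRestrict.1 hYc').add p.continuous⟩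
  have hy : ∀ t, y t = Y t + p t := fun _ => rfl
  refine ⟨y, fun t => ?_, ?_, fun t => ?_⟩
  · rw [hy, hpeq]
    congr 1
    refine intervalIntegral.integral_congr fun τ hτ => ?_
    rw [uIcc_of_le t.2.1] at hτ
    have hτ' : τ ∈ Icc 0 T₀ := ⟨hτ.1, hτ.2.trans t.2.2⟩
    rw [IccExtend_of_mem hT₀pos.le y hτ', ODE.FunSpace.compProj_of_mem hτ', hy]
  · refine (ContinuousMap.norm_le _ (by positivity)).2 fun t => ?_
    have := mem_closedBall_zero_iff.1 (hp1 t)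
    rw [hy]
    linarith
  · have := hBN _ (hp1 t)
    rw [hy]
    linarith

end

end BonaSmith

/-! ### The Bona–Smith system as a vector field on `H²_w × H^k_w`. -/

namespace BonaSmith

noncomputable section

set_option linter.unusedSectionVars false

open Filter Topology BoundedContinuousFunction

/-- The path `t ↦ f₀ + (g₁ t - g₁ 0) e₂ + (g₂ t - g₂ 0) e₁`. -/
def liftPath {F : Type*} [NormedAddCommGroup F] [NormedSpace ℝ F] (e₂ e₁ f₀ : F) (g₁ g₂ : ℝ → ℝ)
    (t : ℝ) : F :=
  f₀ + (g₁ t - g₁ 0) • e₂ + (g₂ t - g₂ 0) • e₁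

section LiftPath

variable {F : Type*} [NormedAddCommGroup F] [NormedSpace ℝ F] {e₂ e₁ f₀ : F} {g₁ g₂ : ℝ → ℝ} {T : ℝ}

theorem continuousOn_liftPath (h₁ : ContinuousOn g₁ (Icc 0 T)) (h₂ : ContinuousOn g₂ (Icc 0 T)) :
    ContinuousOn (liftPath e₂ e₁ f₀ g₁ g₂) (Icc 0 T) := by
  unfold liftPath; fun_prop

theorem norm_liftPath_le {R M t : ℝ} (hT : 0 < T) (hR : ‖f₀‖ ≤ R)
    (h₁ : ∀ t ∈ Icc 0 T, |g₁ t| ≤ M) (h₂ : ∀ t ∈ Icc 0 T, |g₂ t| ≤ M) (ht : t ∈ Icc 0 T) :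
    ‖liftPath e₂ e₁ f₀ g₁ g₂ t‖ ≤ R + 2 * M * (‖e₂‖ + ‖e₁‖) := by
  have h0 : (0 : ℝ) ∈ Icc 0 T := left_mem_Icc.2 hT.le
  have hg : ∀ g : ℝ → ℝ, (∀ t ∈ Icc 0 T, |g t| ≤ M) → ∀ e : F,
      ‖(g t - g 0) • e‖ ≤ 2 * M * ‖e‖ := fun g hg e => by
    rw [norm_smul, Real.norm_eq_abs]
    gcongr
    refine (abs_sub _ _).trans ?_
    linarith [hg t ht, hg 0 h0]
  refine (norm_add₃_le).trans ?_
  linarith [hg g₁ h₁ e₂, hg g₂ h₂ e₁]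

theorem hasDerivWithinAt_liftPath {s : Set ℝ} {t g₁' g₂' : ℝ} (h₁ : HasDerivWithinAt g₁ g₁' s t)
    (h₂ : HasDerivWithinAt g₂ g₂' s t) :
    HasDerivWithinAt (liftPath e₂ e₁ f₀ g₁ g₂) (g₁' • e₂ + g₂' • e₁) s t :=
  (((h₁.sub_const _).smul_const e₂).const_add f₀).add ((h₂.sub_const _).smul_const e₁)

end LiftPath

theorem isTimeDeriv_of_hasDerivWithinAt {E : Type*} [NormedAddCommGroup E] [NormedSpace ℝ E]
    {T : ℝ} {hT : 0 ≤ T} {v v' : C(Icc (0 : ℝ) T, E)} {f : ℝ → E} (hv : ∀ t, v t = f t)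
    (hf : ∀ t : Icc (0 : ℝ) T, HasDerivWithinAt f (v' t) (Icc 0 T) t) : IsTimeDeriv hT v v' :=
  fun t => (hf t).congr_of_mem (fun x hx => by rw [IccExtend_of_mem hT v hx, hv]) t.2

variable {μ : ℝ} [Fact (-1 < μ)] [Fact (μ < 1)]

theorem exists_Hw_two {F₀ F₁ F₂ : ℝ →ᵇ ℝ} (h₀ : IsPrimitive F₀ (toL2w F₁ : L2w μ))
    (h₁ : IsPrimitive F₁ (toL2w F₂ : L2w μ)) : ∃ e : Hw μ 2, component 0 e = toL2w F₀ := by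
  refine ⟨liftHw ![ContinuousLinearMap.toSpanSingleton ℝ (toL2w F₀ : L2w μ),
    ContinuousLinearMap.toSpanSingleton ℝ (toL2w F₁ : L2w μ),
    ContinuousLinearMap.toSpanSingleton ℝ (toL2w F₂ : L2w μ)] (fun a j => ?_) (1 : ℝ), ?_⟩
  · fin_cases j
    · have := (h₀.smul a).hasWeakDeriv
      rwa [map_smul] at this
    · have := (h₁.smul a).hasWeakDeriv
      rwa [map_smul] at this
  · exact one_smul ℝ _

/-- With these elements the liftings `H` and `U` become paths in the Sobolev spaces themselves,
continuous or `C¹` in time according to the boundary data. -/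
theorem exists_component_eq_W (b : ℝ) : ∃ e₁ e₂ : Hw μ 2,
    component 0 e₁ = (Real.sinh (2 / √b))⁻¹ • toL2w (W₁ b) ∧
    component 0 e₂ = (Real.sinh (2 / √b))⁻¹ • toL2w (W₂ b) := by
  obtain ⟨e₁, he₁⟩ := exists_Hw_two (μ := μ) (F₀ := W₁ b) (F₁ := (√b)⁻¹ • K₁ b)
    (F₂ := (√b)⁻¹ • (√b)⁻¹ • W₁ b)
    (by rw [map_smul]; exact isPrimitive_W₁ b)
    (by rw [map_smul, map_smul]; exact (isPrimitive_K₁ b).smul _)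
  obtain ⟨e₂, he₂⟩ := exists_Hw_two (μ := μ) (F₀ := W₂ b) (F₁ := -(√b)⁻¹ • K₂ b)
    (F₂ := -(√b)⁻¹ • -(√b)⁻¹ • W₂ b)
    (by rw [map_smul]; exact isPrimitive_W₂ b)
    (by rw [map_smul, map_smul]; exact (isPrimitive_K₂ b).smul _)
  exact ⟨(Real.sinh (2 / √b))⁻¹ • e₁, (Real.sinh (2 / √b))⁻¹ • e₂, by rw [map_smul, he₁],
    by rw [map_smul, he₂]⟩

theorem component_add_ae {k : ℕ} (f g : Hw μ k) : ∀ᵐ x ∂volume.restrict (Ioo (-1 : ℝ) 1),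
    component 0 (f + g) x = component 0 f x + component 0 g x := by
  rw [map_add]
  exact ae_jacobiMeasure (Lp.coeFn_add _ _)

theorem component_sub_ae {k : ℕ} (f g : Hw μ k) : ∀ᵐ x ∂volume.restrict (Ioo (-1 : ℝ) 1),
    component 0 (f - g) x = component 0 f x - component 0 g x := by
  rw [map_sub]
  exact ae_jacobiMeasure (Lp.coeFn_sub _ _)

theorem component_liftPath {k : ℕ} {b : ℝ} {e₁ e₂ : Hw μ k}
    (h₁ : component 0 e₁ = (Real.sinh (2 / √b))⁻¹ • toL2w (W₁ b))
    (h₂ : component 0 e₂ = (Real.sinh (2 / √b))⁻¹ • toL2w (W₂ b))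
    (f₀ : Hw μ k) (g₁ g₂ : ℝ → ℝ) (t : ℝ) : ∀ᵐ x ∂volume.restrict (Ioo (-1 : ℝ) 1),
      component 0 (liftPath e₂ e₁ f₀ g₁ g₂ t) x = lift b (val f₀) g₁ g₂ x t := by
  have e : component 0 (liftPath e₂ e₁ f₀ g₁ g₂ t) = component 0 f₀ +
      toL2w (((g₁ t - g₁ 0) * (Real.sinh (2 / √b))⁻¹) • W₂ b +
        ((g₂ t - g₂ 0) * (Real.sinh (2 / √b))⁻¹) • W₁ b) := by
    simp only [liftPath, map_add, map_smul, h₁, h₂, smul_smul, add_assoc]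
  rw [e]
  filter_upwards [ae_jacobiMeasure (Lp.coeFn_add (component 0 f₀)
      (toL2w (((g₁ t - g₁ 0) * (Real.sinh (2 / √b))⁻¹) • W₂ b +
        ((g₂ t - g₂ 0) * (Real.sinh (2 / √b))⁻¹) • W₁ b))),
    coeFn_toL2w (μ := μ) (((g₁ t - g₁ 0) * (Real.sinh (2 / √b))⁻¹) • W₂ b +
        ((g₂ t - g₂ 0) * (Real.sinh (2 / √b))⁻¹) • W₁ b),
    ae_restrict_mem measurableSet_Ioo] with x hx1 hx2 hx
  rw [hx1, Pi.add_apply, hx2, BoundedContinuousFunction.add_apply,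
    BoundedContinuousFunction.coe_smul, BoundedContinuousFunction.coe_smul]
  beta_reduce
  rw [W₁, W₂, clamp_apply _ (Ioo_subset_Icc_self hx), clamp_apply _ (Ioo_subset_Icc_self hx), lift, val_eq,
    smul_eq_mul, smul_eq_mul]
  ring

/-- Bilinearity: the difference of the products is `P y · Q(y - z) + P(y - z) · Q z`. -/
theorem quadLip_mulHw {E : Type*} [NormedAddCommGroup E] [NormedSpace ℝ E]
    (P Q : E →L[ℝ] Hw μ 1) : QuadLip fun y => mulHw (P y) (Q y) := by
  obtain ⟨C, hC0, hC⟩ := exists_norm_mulHw_le (μ := μ)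
  refine ⟨C * ‖P‖ * ‖Q‖, by positivity, fun y z => ?_⟩
  have e : mulHw (P y) (Q y) - mulHw (P z) (Q z) =
      mulHw (P y) (Q (y - z)) + mulHw (P (y - z)) (Q z) := by
    rw [map_sub Q, map_sub P, mulHw_sub_left, map_sub]
    abel
  have key : ∀ v w, ‖mulHw (P v) (Q w)‖ ≤ C * ‖P‖ * ‖Q‖ * (‖v‖ * ‖w‖) := fun v w =>
    calc _ ≤ C * ‖P v‖ * ‖Q w‖ := hC _ _
      _ ≤ C * (‖P‖ * ‖v‖) * (‖Q‖ * ‖w‖) := by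
          gcongr
          · exact P.le_opNorm v
          · exact Q.le_opNorm w
      _ = _ := by ring
  rw [e]
  refine (norm_add_le_of_le (key y (y - z)) (key (y - z) z)).trans ?_
  have : ‖y‖ * ‖y - z‖ + ‖y - z‖ * ‖z‖ ≤ (1 + ‖y‖ + ‖z‖) * ‖y - z‖ := by
    nlinarith [norm_nonneg (y - z)]
  rw [← mul_add, mul_assoc (C * ‖P‖ * ‖Q‖)]
  gcongr

/-- The two nonlinearities of the system and the resulting vector field on `H²_w × H^k_w`. -/
structure IsSystem {k : ℕ} (b c : ℝ) (B : Hw μ 2 × Hw μ k → Hw μ 2 × Hw μ k)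
    (n₁ n₂ : Hw μ 2 × Hw μ k → L2w μ) : Prop where
  quadLip : QuadLip B
  map_zero : B 0 = 0
  continuous₁ : Continuous n₁
  continuous₂ : Continuous n₂
  component₁ : ∀ y, component 0 (B y).1 = toL2w (greenOp b (n₁ y))
  component₂ : ∀ y, component 0 (B y).2 = toL2w (greenOp b (n₂ y))
  apply₁ : ∀ y, ∀ᵐ x ∂volume.restrict (Ioo (-1 : ℝ) 1),
    n₁ y x = val y.2 x + val y.1 x * val y.2 x
  apply₂ : ∀ y, ∀ᵐ x ∂volume.restrict (Ioo (-1 : ℝ) 1),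
    n₂ y x = c * wderiv 2 y.1 x + val y.1 x + val y.2 x ^ 2 / 2

/-- `u + ηu` is in `H¹_w`, so its image under `A_D` is in `H²_w`; `c η_xx` is only in `L²_w`, so the
second component reaches no further than `H¹_w`. -/
theorem exists_isSystem_one {b : ℝ} (hb : 0 < b) (c : ℝ) :
    ∃ (B : Hw μ 2 × Hw μ 1 → Hw μ 2 × Hw μ 1) (n₁ n₂ : Hw μ 2 × Hw μ 1 → L2w μ),
      IsSystem b c B n₁ n₂ := by
  let p₁ : Hw μ 2 × Hw μ 1 →L[ℝ] Hw μ 2 := ContinuousLinearMap.fst ℝ _ _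
  let p₂ : Hw μ 2 × Hw μ 1 →L[ℝ] Hw μ 1 := ContinuousLinearMap.snd ℝ _ _
  let N₁ : Hw μ 2 × Hw μ 1 → Hw μ 1 := fun y => p₂ y + mulHw ((inclHw.comp p₁) y) (p₂ y)
  let n₂ : Hw μ 2 × Hw μ 1 → L2w μ := fun y =>
    (c • (component 2).comp p₁ + (component 0).comp p₁) y +
      ((1 / 2 : ℝ) • component 0) (mulHw (p₂ y) (p₂ y))
  have hN₁ : QuadLip N₁ := (ContinuousLinearMap.quadLip p₂).add (quadLip_mulHw _ _)
  have hn₂ : QuadLip n₂ := (ContinuousLinearMap.quadLip _).add ((quadLip_mulHw _ _).clm_comp _)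
  refine ⟨fun y => (greenHw hb (N₁ y), greenL2w hb (n₂ y)), fun y => component 0 (N₁ y), n₂,
    (hN₁.clm_comp _).prodMk (hn₂.clm_comp _), ?_, (component 0).continuous.comp hN₁.continuous,
    hn₂.continuous, fun y => rfl, fun y => rfl, fun y => ?_, fun y => ?_⟩
  · simp [N₁, n₂]
  · filter_upwards [component_add_ae y.2 (mulHw (inclHw y.1) y.2),
      component_mulHw (inclHw y.1) y.2] with x h1 h2
    rw [val_eq, val_eq, ← component_inclHw, ← h2, ← h1]
    rfl
  · have e : n₂ y = c • component 2 y.1 + component 0 y.1 +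
        (1 / 2 : ℝ) • component 0 (mulHw y.2 y.2) := rfl
    rw [e]
    filter_upwards [ae_jacobiMeasure (Lp.coeFn_add (c • component 2 y.1 + component 0 y.1)
        ((1 / 2 : ℝ) • component 0 (mulHw y.2 y.2))),
      ae_jacobiMeasure (Lp.coeFn_add (c • component 2 y.1) (component 0 y.1)),
      ae_jacobiMeasure (Lp.coeFn_smul c (component 2 y.1)),
      ae_jacobiMeasure (Lp.coeFn_smul (1 / 2 : ℝ) (component 0 (mulHw y.2 y.2))),
      component_mulHw y.2 y.2] with x h1 h2 h3 h4 h5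
    rw [h1, Pi.add_apply, h2, Pi.add_apply, h3, h4, Pi.smul_apply, Pi.smul_apply, h5, wderiv_eq,
      val_eq, val_eq, smul_eq_mul, smul_eq_mul]
    ring

/-- Without `η_xx` both nonlinearities lie in `H¹_w`, and `A_D` sends both to `H²_w`. -/
theorem exists_isSystem_two {b : ℝ} (hb : 0 < b) :
    ∃ (B : Hw μ 2 × Hw μ 2 → Hw μ 2 × Hw μ 2) (n₁ n₂ : Hw μ 2 × Hw μ 2 → L2w μ),
      IsSystem b 0 B n₁ n₂ := by
  let p₁ : Hw μ 2 × Hw μ 2 →L[ℝ] Hw μ 1 := inclHw.comp (ContinuousLinearMap.fst ℝ _ _)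
  let p₂ : Hw μ 2 × Hw μ 2 →L[ℝ] Hw μ 1 := inclHw.comp (ContinuousLinearMap.snd ℝ _ _)
  let N₁ : Hw μ 2 × Hw μ 2 → Hw μ 1 := fun y => p₂ y + mulHw (p₁ y) (p₂ y)
  let N₂ : Hw μ 2 × Hw μ 2 → Hw μ 1 := fun y =>
    p₁ y + ((1 / 2 : ℝ) • ContinuousLinearMap.id ℝ (Hw μ 1)) (mulHw (p₂ y) (p₂ y))
  have hN₁ : QuadLip N₁ := (ContinuousLinearMap.quadLip p₂).add (quadLip_mulHw _ _)
  have hN₂ : QuadLip N₂ := (ContinuousLinearMap.quadLip p₁).add ((quadLip_mulHw _ _).clm_comp _)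
  refine ⟨fun y => (greenHw hb (N₁ y), greenHw hb (N₂ y)), fun y => component 0 (N₁ y),
    fun y => component 0 (N₂ y),
    (hN₁.clm_comp _).prodMk (hN₂.clm_comp _), ?_, (component 0).continuous.comp hN₁.continuous,
    (component 0).continuous.comp hN₂.continuous, fun y => rfl, fun y => rfl, fun y => ?_,
    fun y => ?_⟩
  · simp [N₁, N₂]
  · filter_upwards [component_add_ae (inclHw y.2) (mulHw (inclHw y.1) (inclHw y.2)),
      component_mulHw (inclHw y.1) (inclHw y.2)] with x h1 h2
    rw [val_eq, val_eq, ← component_inclHw, ← component_inclHw, ← h2, ← h1]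
    rfl
  · have e : component 0 (N₂ y) = component 0 y.1 +
        (1 / 2 : ℝ) • component 0 (mulHw (inclHw y.2) (inclHw y.2)) := rfl
    rw [e]
    filter_upwards [ae_jacobiMeasure (Lp.coeFn_add (component 0 y.1)
        ((1 / 2 : ℝ) • component 0 (mulHw (inclHw y.2) (inclHw y.2)))),
      ae_jacobiMeasure (Lp.coeFn_smul (1 / 2 : ℝ)
        (component 0 (mulHw (inclHw y.2) (inclHw y.2)))),
      component_mulHw (inclHw y.2) (inclHw y.2)] with x h1 h4 h5
    rw [h1, Pi.add_apply, h4, Pi.smul_apply, h5, component_inclHw, val_eq, val_eq, smul_eq_mul]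
    ring

/-- Time integrals in `H^k_w` are computed pointwise in space. -/
theorem component_integral {E : Type*} [NormedAddCommGroup E] [NormedSpace ℝ E] [CompleteSpace E]
    {k : ℕ} {b : ℝ} (hb : 0 < b) (P : E →L[ℝ] Hw μ k) {g : ℝ → E} (hg : Continuous g)
    {n : ℝ → L2w μ} (hn : Continuous n)
    (h : ∀ τ, component 0 (P (g τ)) = toL2w (greenOp b (n τ))) (t : ℝ) :
    ∀ᵐ x ∂volume.restrict (Ioo (-1 : ℝ) 1),
      component 0 (P (∫ τ in (0 : ℝ)..t, g τ)) x = ∫ τ in (0 : ℝ)..t, solOp b (n τ) x := by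
  have hni := hn.intervalIntegrable (μ := volume) 0 t
  have e : component 0 (P (∫ τ in (0 : ℝ)..t, g τ)) =
      (toL2w (greenOp b (∫ τ in (0 : ℝ)..t, n τ)) : L2w μ) := by
    have h1 := ((component 0).comp P).intervalIntegral_comp_comm
      (hg.intervalIntegrable (μ := volume) 0 t)
    have h2 := ((toL2w : _ →L[ℝ] L2w μ).comp (greenOp (μ := μ) b)).intervalIntegral_comp_comm hni
    refine h1.symm.trans (Eq.trans ?_ h2)
    exact intervalIntegral.integral_congr fun τ _ => h τ
  rw [e]
  filter_upwards [coeFn_toL2w (μ := μ) (greenOp b (∫ τ in (0 : ℝ)..t, n τ)),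
    ae_restrict_mem measurableSet_Ioo] with x hx hxI
  rw [hx]
  -- Evaluation at `x` is a bounded functional on bounded continuous functions, so it commutes with
  -- the time integral; it would make no sense on `L²_w`.
  refine (((BoundedContinuousFunction.evalCLM ℝ x).comp
    (greenOp (μ := μ) b)).intervalIntegral_comp_comm hni).symm.trans ?_
  exact intervalIntegral.integral_congr fun τ _ => (solOp_eq_greenOp hb (n τ) hxI).symm

theorem Hw_eq_iff_ae {k : ℕ} {f g : Hw μ k} {g' : ℝ → ℝ}
    (hg : ∀ᵐ x ∂volume.restrict (Ioo (-1 : ℝ) 1), component 0 g x = g' x) :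
    f = g ↔ ∀ᵐ x ∂volume.restrict (Ioo (-1 : ℝ) 1), val f x = g' x := by
  constructor
  · rintro rfl
    exact hg
  · intro h
    refine Hw_ext (L2w_ext ?_)
    filter_upwards [h, hg] with x h1 h2
    rw [h2, ← h1, val_eq]

/-- One direction turns the abstract solution into a solution of the system; the other transfers
uniqueness back. -/
theorem IsSystem.isIntegralSolution_iff {k : ℕ} {b c : ℝ} (hb : 0 < b)
    {B : Hw μ 2 × Hw μ k → Hw μ 2 × Hw μ k} {n₁ n₂ : Hw μ 2 × Hw μ k → L2w μ}
    (hB : IsSystem b c B n₁ n₂) {e₁ e₂ : Hw μ 2} {e₁' e₂' : Hw μ k}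
    (h₁ : component 0 e₁ = (Real.sinh (2 / √b))⁻¹ • toL2w (W₁ b))
    (h₂ : component 0 e₂ = (Real.sinh (2 / √b))⁻¹ • toL2w (W₂ b))
    (h₁' : component 0 e₁' = (Real.sinh (2 / √b))⁻¹ • toL2w (W₁ b))
    (h₂' : component 0 e₂' = (Real.sinh (2 / √b))⁻¹ • toL2w (W₂ b))
    {T : ℝ} (hT : 0 ≤ T) (η₀ : Hw μ 2) (u₀ : Hw μ k) (g₁ g₂ v₁ v₂ : ℝ → ℝ)
    (η : CHw T μ 2) (u : CHw T μ k) :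
    IsIntegralSolution b c hT η₀ u₀ g₁ g₂ v₁ v₂ η u ↔
      ∀ t : Icc (0 : ℝ) T, (η.prodMk u) t =
        (liftPath e₂ e₁ η₀ g₁ g₂ t, liftPath e₂' e₁' u₀ v₁ v₂ t) +
          ∫ τ in (0 : ℝ)..t, B (IccExtend hT (η.prodMk u) τ) := by
  set y := η.prodMk u
  have hy : Continuous (IccExtend hT y) := continuous_IccExtend_iff.2 y.continuous
  have hg := hB.quadLip.continuous.comp hy
  have hη : ∀ t : ℝ, ∀ᵐ x ∂volume.restrict (Ioo (-1 : ℝ) 1),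
      component 0 (liftPath e₂ e₁ η₀ g₁ g₂ t + (∫ τ in (0 : ℝ)..t, B (IccExtend hT y τ)).1) x =
        lift b (val η₀) g₁ g₂ x t + ∫ τ in (0 : ℝ)..t, solOp b (fun ξ =>
        val (IccExtend hT u τ) ξ + val (IccExtend hT η τ) ξ * val (IccExtend hT u τ) ξ) x := by
    intro t
    filter_upwards [component_add_ae (liftPath e₂ e₁ η₀ g₁ g₂ t)
        (∫ τ in (0 : ℝ)..t, B (IccExtend hT y τ)).1,
      component_liftPath h₁ h₂ η₀ g₁ g₂ t,
      component_integral hb (ContinuousLinearMap.fst ℝ (Hw μ 2) (Hw μ k)) hg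
        (hB.continuous₁.comp hy) (fun τ => hB.component₁ _) t] with x hx1 hx2 hx3
    rw [hx1, hx2]
    congr 1
    refine hx3.trans (intervalIntegral.integral_congr fun τ _ => ?_)
    exact congrFun (solOp_congr b (hB.apply₁ (IccExtend hT y τ))) x
  have hu : ∀ t : ℝ, ∀ᵐ x ∂volume.restrict (Ioo (-1 : ℝ) 1),
      component 0 (liftPath e₂' e₁' u₀ v₁ v₂ t + (∫ τ in (0 : ℝ)..t, B (IccExtend hT y τ)).2) x =
        lift b (val u₀) v₁ v₂ x t + ∫ τ in (0 : ℝ)..t, solOp b (fun ξ =>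
        c * wderiv 2 (IccExtend hT η τ) ξ + val (IccExtend hT η τ) ξ
          + val (IccExtend hT u τ) ξ ^ 2 / 2) x := by
    intro t
    filter_upwards [component_add_ae (liftPath e₂' e₁' u₀ v₁ v₂ t)
        (∫ τ in (0 : ℝ)..t, B (IccExtend hT y τ)).2,
      component_liftPath h₁' h₂' u₀ v₁ v₂ t,
      component_integral hb (ContinuousLinearMap.snd ℝ (Hw μ 2) (Hw μ k)) hg
        (hB.continuous₂.comp hy) (fun τ => hB.component₂ _) t] with x hx1 hx2 hx3
    rw [hx1, hx2]
    congr 1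
    refine hx3.trans (intervalIntegral.integral_congr fun τ _ => ?_)
    exact congrFun (solOp_congr b (hB.apply₂ (IccExtend hT y τ))) x
  constructor
  · intro h t
    exact Prod.ext ((Hw_eq_iff_ae (hη t)).2 (h.eq_η t)) ((Hw_eq_iff_ae (hu t)).2 (h.eq_u t))
  · intro h
    exact ⟨fun t => (Hw_eq_iff_ae (hη t)).1 (congrArg Prod.fst (h t)),
      fun t => (Hw_eq_iff_ae (hu t)).1 (congrArg Prod.snd (h t))⟩

end

end BonaSmith

/-! ### Time regularity and the main theorem. -/

namespace BonaSmith

noncomputable section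

set_option linter.unusedSectionVars false

variable {μ : ℝ} [Fact (-1 < μ)] [Fact (μ < 1)]

theorem exists_isSystem {b c : ℝ} (hb : 0 < b) {k : ℕ} (hk : (c < 0 ∧ k = 1) ∨ (c = 0 ∧ k = 2)) :
    ∃ (B : Hw μ 2 × Hw μ k → Hw μ 2 × Hw μ k) (n₁ n₂ : Hw μ 2 × Hw μ k → L2w μ)
      (e₁ e₂ : Hw μ k), IsSystem b c B n₁ n₂ ∧
      component 0 e₁ = (Real.sinh (2 / √b))⁻¹ • toL2w (W₁ b) ∧
      component 0 e₂ = (Real.sinh (2 / √b))⁻¹ • toL2w (W₂ b) := by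
  obtain ⟨e₁, e₂, he₁, he₂⟩ := exists_component_eq_W (μ := μ) b
  rcases hk with ⟨-, rfl⟩ | ⟨rfl, rfl⟩
  · obtain ⟨B, n₁, n₂, hB⟩ := exists_isSystem_one (μ := μ) hb c
    exact ⟨B, n₁, n₂, inclHw e₁, inclHw e₂, hB, he₁, he₂⟩
  · obtain ⟨B, n₁, n₂, hB⟩ := exists_isSystem_two (μ := μ) hb
    exact ⟨B, n₁, n₂, e₁, e₂, hB, he₁, he₂⟩

/-- Time regularity of the component `P y` of a solution of `y = Y + ∫ B(y)`, where `P Y` is the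
lifting of the boundary data. -/
theorem time_regularity {E : Type*} [NormedAddCommGroup E] [NormedSpace ℝ E] [CompleteSpace E]
    {b : ℝ} {k : ℕ} {e₁ e₂ : Hw μ k}
    (h₁ : component 0 e₁ = (Real.sinh (2 / √b))⁻¹ • toL2w (W₁ b))
    (h₂ : component 0 e₂ = (Real.sinh (2 / √b))⁻¹ • toL2w (W₂ b))
    (P : E →L[ℝ] Hw μ k) {T T₀ C : ℝ} (hT₀ : 0 < T₀) (hTT : T₀ ≤ T) {g : ℝ → E}
    (hg : Continuous g) (hgC : ∀ t ∈ Icc 0 T₀, ‖P (g t)‖ ≤ C) {f₀ : Hw μ k} {g₁ g₂ : ℝ → ℝ}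
    {v : CHw T₀ μ k}
    (hv : ∀ t : Icc (0 : ℝ) T₀,
      v t = liftPath e₂ e₁ f₀ g₁ g₂ t + P (∫ τ in (0 : ℝ)..t, g τ)) :
    (∃ p p' : CHw T₀ μ k,
      (∀ t : Icc (0 : ℝ) T₀, ∀ᵐ x ∂volume.restrict (Ioo (-1 : ℝ) 1),
        val (p t) x = val (v t) x - lift b (val f₀) g₁ g₂ x t) ∧
      IsTimeDeriv hT₀.le p p' ∧ ‖p'‖ ≤ C) ∧
    ∀ K, (∀ g ∈ [g₁, g₂], ContDiffOn ℝ 1 g (Icc 0 T) ∧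
        ∀ t ∈ Icc 0 T, |derivWithin g (Icc 0 T) t| ≤ K) →
      ∃ v' : CHw T₀ μ k, IsTimeDeriv hT₀.le v v' ∧ ‖v'‖ ≤ K * (‖e₂‖ + ‖e₁‖) + C := by
  have hC : 0 ≤ C := (norm_nonneg _).trans (hgC 0 (left_mem_Icc.2 hT₀.le))
  have hder : ∀ (s : Set ℝ) (t : ℝ),
      HasDerivWithinAt (fun t => P (∫ τ in (0 : ℝ)..t, g τ)) (P (g t)) s t := fun s t =>
    P.hasFDerivAt.comp_hasDerivWithinAt t (hasDerivWithinAt_integral_of_continuous hg t s)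
  have hcont : Continuous fun t => P (∫ τ in (0 : ℝ)..t, g τ) :=
    continuous_iff_continuousAt.2 fun t => (hasDerivWithinAt_univ.1 (hder univ t)).continuousAt
  refine ⟨⟨⟨fun t => P (∫ τ in (0 : ℝ)..t, g τ), hcont.comp continuous_subtype_val⟩,
    ⟨fun t => P (g t), (P.continuous.comp hg).comp continuous_subtype_val⟩, fun t => ?_, ?_, ?_⟩,
    fun K hK => ?_⟩
  · have e : P (∫ τ in (0 : ℝ)..t, g τ) = v t - liftPath e₂ e₁ f₀ g₁ g₂ t := by
      rw [hv, add_sub_cancel_left]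
    change ∀ᵐ x ∂volume.restrict (Ioo (-1 : ℝ) 1), val (P (∫ τ in (0 : ℝ)..t, g τ)) x = _
    rw [e]
    filter_upwards [component_sub_ae (v t) (liftPath e₂ e₁ f₀ g₁ g₂ t),
      component_liftPath h₁ h₂ f₀ g₁ g₂ t] with x hx1 hx2
    rw [val_eq, hx1, hx2, val_eq, val_eq]
  · exact isTimeDeriv_of_hasDerivWithinAt (fun t => rfl) fun t => hder _ t
  · exact (ContinuousMap.norm_le _ hC).2 fun t => hgC t t.2
  · have hT : 0 < T := hT₀.trans_le hTT
    have hsub : Icc 0 T₀ ⊆ Icc 0 T := Icc_subset_Icc_right hTT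
    obtain ⟨hg₁, hK₁⟩ := hK g₁ (by simp)
    obtain ⟨hg₂, hK₂⟩ := hK g₂ (by simp)
    have hc : ∀ g : ℝ → ℝ, ContDiffOn ℝ 1 g (Icc 0 T) →
        ContinuousOn (derivWithin g (Icc 0 T)) (Icc 0 T₀) := fun g hg =>
      (hg.continuousOn_derivWithin (uniqueDiffOn_Icc hT) le_rfl).mono hsub
    have hd : ∀ g : ℝ → ℝ, ContDiffOn ℝ 1 g (Icc 0 T) → ∀ t ∈ Icc 0 T₀,
        HasDerivWithinAt g (derivWithin g (Icc 0 T) t) (Icc 0 T₀) t := fun g hg t ht =>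
      ((hg.differentiableOn (by simp) t (hsub ht)).hasDerivWithinAt).mono hsub
    -- The candidate for the time derivative of `v`: the derivative of the lifting plus the
    -- integrand. The derivatives of the data are taken within `[0, T]` and restricted to `[0, T₀]`.
    have hcv : ContinuousOn (fun t => derivWithin g₁ (Icc 0 T) t • e₂ +
        derivWithin g₂ (Icc 0 T) t • e₁ + P (g t)) (Icc 0 T₀) :=
      (((hc g₁ hg₁).smul continuousOn_const).add ((hc g₂ hg₂).smul continuousOn_const)).add
        (P.continuous.comp hg).continuousOn
    refine ⟨⟨_, continuousOn_iff_continuous_domRestrict.1 hcv⟩, ?_, ?_⟩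
    · exact isTimeDeriv_of_hasDerivWithinAt hv fun t =>
        (hasDerivWithinAt_liftPath (hd g₁ hg₁ t t.2) (hd g₂ hg₂ t t.2)).add (hder _ t)
    · have hK0 : 0 ≤ K := (abs_nonneg _).trans (hK₁ 0 (left_mem_Icc.2 hT.le))
      refine (ContinuousMap.norm_le _ (by positivity)).2 fun t => ?_
      have hs : ∀ (a : ℝ) (e : Hw μ k), |a| ≤ K → ‖a • e‖ ≤ K * ‖e‖ := fun a e ha => by
        rw [norm_smul, Real.norm_eq_abs]
        gcongr
      rw [mul_add]
      exact norm_add_le_of_le (norm_add_le_of_le (hs _ _ (hK₁ t (hsub t.2)))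
        (hs _ _ (hK₂ t (hsub t.2)))) (hgC t t.2)

end

end BonaSmith

theorem mainTheorem1 (μ b c T : ℝ) (hμ : -1 < μ) (hμ' : μ < 1) (hb : 0 < b) (hT : 0 < T)
    (k : ℕ) (hk : (c < 0 ∧ k = 1) ∨ (c = 0 ∧ k = 2)) (R S M : ℝ) :
    ∃ (T₀ : ℝ) (hT₀ : 0 < T₀) (C : ℝ) (D : ℝ → ℝ), T₀ ≤ T ∧
      ∀ (η₀ : BonaSmith.Hw μ 2) (u₀ : BonaSmith.Hw μ k) (h₁ h₂ v₁ v₂ : ℝ → ℝ),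
        ‖η₀‖ ≤ R → ‖u₀‖ ≤ S →
        (∀ g ∈ [h₁, h₂, v₁, v₂],
          ContinuousOn g (Set.Icc 0 T) ∧ ∀ t ∈ Set.Icc 0 T, |g t| ≤ M) →
        BonaSmith.HasBoundaryValues (BonaSmith.val η₀) (h₁ 0) (h₂ 0) →
        BonaSmith.HasBoundaryValues (BonaSmith.val u₀) (v₁ 0) (v₂ 0) →
        ∃ (η : BonaSmith.CHw T₀ μ 2) (u : BonaSmith.CHw T₀ μ k),
          BonaSmith.IsIntegralSolution b c hT₀.le η₀ u₀ h₁ h₂ v₁ v₂ η u ∧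
          (∀ (η' : BonaSmith.CHw T₀ μ 2) (u' : BonaSmith.CHw T₀ μ k),
            BonaSmith.IsIntegralSolution b c hT₀.le η₀ u₀ h₁ h₂ v₁ v₂ η' u' →
              η' = η ∧ u' = u) ∧
          (∃ (p p' : BonaSmith.CHw T₀ μ 2) (q q' : BonaSmith.CHw T₀ μ k),
            (∀ t : Set.Icc (0 : ℝ) T₀, ∀ᵐ x ∂volume.restrict (Set.Ioo (-1 : ℝ) 1),
              BonaSmith.val (p t) x =
                BonaSmith.val (η t) x - BonaSmith.lift b (BonaSmith.val η₀) h₁ h₂ x t) ∧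
            (∀ t : Set.Icc (0 : ℝ) T₀, ∀ᵐ x ∂volume.restrict (Set.Ioo (-1 : ℝ) 1),
              BonaSmith.val (q t) x =
                BonaSmith.val (u t) x - BonaSmith.lift b (BonaSmith.val u₀) v₁ v₂ x t) ∧
            BonaSmith.IsTimeDeriv hT₀.le p p' ∧ BonaSmith.IsTimeDeriv hT₀.le q q' ∧
            ‖η‖ + ‖p'‖ ≤ C ∧ ‖u‖ + ‖q'‖ ≤ C) ∧
          ∀ K : ℝ,
            (∀ g ∈ [h₁, h₂, v₁, v₂], ContDiffOn ℝ 1 g (Set.Icc 0 T) ∧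
              ∀ t ∈ Set.Icc 0 T, |derivWithin g (Set.Icc 0 T) t| ≤ K) →
            ∃ (η' : BonaSmith.CHw T₀ μ 2) (u' : BonaSmith.CHw T₀ μ k),
              BonaSmith.IsTimeDeriv hT₀.le η η' ∧ BonaSmith.IsTimeDeriv hT₀.le u u' ∧
              ‖η‖ + ‖η'‖ ≤ D K ∧ ‖u‖ + ‖u'‖ ≤ D K := by
  open BonaSmith in
  have : Fact (-1 < μ) := ⟨hμ⟩
  have : Fact (μ < 1) := ⟨hμ'⟩
  obtain ⟨B, n₁, n₂, e₁', e₂', hB, he₁', he₂'⟩ := exists_isSystem (μ := μ) (c := c) hb hk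
  obtain ⟨e₁, e₂, he₁, he₂⟩ := exists_component_eq_W (μ := μ) b
  set r₁ := R + 2 * M * (‖e₂‖ + ‖e₁‖)
  set r₂ := S + 2 * M * (‖e₂'‖ + ‖e₁'‖)
  -- Time and constant are fixed before the data, from the bounds alone. The maximum with 0 is there
  -- because `R`, `S`, `M` are arbitrary reals.
  obtain ⟨T₀, hT₀, C, hTT, hsol⟩ := exists_volterra hB.quadLip hB.map_zero hT
    (ρ := max 0 (max r₁ r₂)) (le_max_left _ _)
  -- A single function of `K` serves both components by summing their contributions; `|K|` keeps
  -- each summand nonnegative for every real `K`.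
  refine ⟨T₀, hT₀, C + C,
    fun K => C + (|K| * (‖e₂‖ + ‖e₁‖) + |K| * (‖e₂'‖ + ‖e₁'‖) + C), hTT, ?_⟩
  intro η₀ u₀ h₁ h₂ v₁ v₂ hη₀ hu₀ hg _ _
  obtain ⟨hh₁, hh₁M⟩ := hg h₁ (by simp)
  obtain ⟨hh₂, hh₂M⟩ := hg h₂ (by simp)
  obtain ⟨hv₁, hv₁M⟩ := hg v₁ (by simp)
  obtain ⟨hv₂, hv₂M⟩ := hg v₂ (by simp)
  obtain ⟨y, hy, hyC, hByC⟩ := hsol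
    (fun t => (liftPath e₂ e₁ η₀ h₁ h₂ t, liftPath e₂' e₁' u₀ v₁ v₂ t))
    ((continuousOn_liftPath hh₁ hh₂).prodMk (continuousOn_liftPath hv₁ hv₂))
    (fun t ht => (max_le_max (norm_liftPath_le hT hη₀ hh₁M hh₂M ht)
      (norm_liftPath_le hT hu₀ hv₁M hv₂M ht)).trans (le_max_right _ _))
  have hC : 0 ≤ C := (norm_nonneg _).trans hyC
  let η : CHw T₀ μ 2 := ⟨fun t => (y t).1, continuous_fst.comp y.continuous⟩
  let u : CHw T₀ μ k := ⟨fun t => (y t).2, continuous_snd.comp y.continuous⟩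
  have hηu : η.prodMk u = y := rfl
  have hiff := hB.isIntegralSolution_iff hb he₁ he₂ he₁' he₂' hT₀.le η₀ u₀ h₁ h₂ v₁ v₂
  have hηC : ‖η‖ ≤ C := (ContinuousMap.norm_le _ hC).2 fun t =>
    (norm_fst_le (y t)).trans ((y.norm_coe_le_norm t).trans hyC)
  have huC : ‖u‖ ≤ C := (ContinuousMap.norm_le _ hC).2 fun t =>
    (norm_snd_le (y t)).trans ((y.norm_coe_le_norm t).trans hyC)
  have hgc : Continuous fun τ => B (Set.IccExtend hT₀.le y τ) :=
    hB.quadLip.continuous.comp (continuous_IccExtend_iff.2 y.continuous)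
  have hgC : ∀ τ, ‖B (Set.IccExtend hT₀.le y τ)‖ ≤ C := fun τ => hByC _
  obtain ⟨⟨p, p', hp, hpp', hp'⟩, hη'⟩ := time_regularity he₁ he₂
    (ContinuousLinearMap.fst ℝ (Hw μ 2) (Hw μ k)) hT₀ hTT hgc (C := C)
    (fun t _ => (norm_fst_le _).trans (hgC t)) (f₀ := η₀) (g₁ := h₁) (g₂ := h₂) (v := η)
    (fun t => congrArg Prod.fst (hy t))
  obtain ⟨⟨q, q', hq, hqq', hq'⟩, hu'⟩ := time_regularity he₁' he₂'
    (ContinuousLinearMap.snd ℝ (Hw μ 2) (Hw μ k)) hT₀ hTT hgc (C := C)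
    (fun t _ => (norm_snd_le _).trans (hgC t)) (f₀ := u₀) (g₁ := v₁) (g₂ := v₂) (v := u)
    (fun t => congrArg Prod.snd (hy t))
  refine ⟨η, u, (hiff η u).2 hy, fun η' u' h => ?_,
    ⟨p, p', q, q', hp, hq, hpp', hqq', add_le_add hηC hp', add_le_add huC hq'⟩, fun K hK => ?_⟩
  · have h' := volterra_unique hB.quadLip hT₀.le
      (Y := fun t => (liftPath e₂ e₁ η₀ h₁ h₂ t, liftPath e₂' e₁' u₀ v₁ v₂ t))
      ((hiff η' u').1 h) hy
    exact ⟨ContinuousMap.ext fun t => congrArg Prod.fst (DFunLike.congr_fun h' t),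
      ContinuousMap.ext fun t => congrArg Prod.snd (DFunLike.congr_fun h' t)⟩
  · obtain ⟨η', hηη', hη'C⟩ := hη' K fun g hg => hK g (by simp at hg ⊢; tauto)
    obtain ⟨u', huu', hu'C⟩ := hu' K fun g hg => hK g (by simp at hg ⊢; tauto)
    have hle : ∀ a : ℝ, 0 ≤ a → K * a ≤ |K| * a := fun a ha =>
      mul_le_mul_of_nonneg_right (le_abs_self K) ha
    have ha := hle (‖e₂‖ + ‖e₁‖) (by positivity)
    have hb' := hle (‖e₂'‖ + ‖e₁'‖) (by positivity)
    have ha0 : 0 ≤ |K| * (‖e₂‖ + ‖e₁‖) := by positivity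
    have hb0 : 0 ≤ |K| * (‖e₂'‖ + ‖e₁'‖) := by positivity
    exact ⟨η', u', hηη', huu', by linarith, by linarith⟩
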